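/- All super-rings are $\mathbb Z/2$-graded unital rings $R=R_0\oplus R_1$ that are super-commutative: even elements commute with all homogeneous elements, and $s^2=0$ for every odd $s$. A superscheme is a topological space with a sheaf of such super-rings all of whose stalks are local, which is locally isomorphic to affine superschemes $\mathrm{SSpec}\,R$ (the space of prime super-ideals of $R$ with its structure sheaf of functions that are locally fractions). A superscheme over a field $K$ is of finite type if it has a finite covering by open affine super-subschemes whose super-rings of sections are finitely generated $K$-superalgebras. It is irreducible if its underlying topological space is irreducible (in particular non-empty). For a Noetherian super-ring $R$ with $\mathrm{Kdim}(R_0)<\infty$, odd elements $y_1,\dots,y_s\in R_1$ form a system of odd parameters if $\mathrm{Kdim}(R_0)=\mathrm{Kdim}(R_0/\mathrm{Ann}_{R_0}(y_1\cdots y_s))$. The Krull super-dimension of $R$ is $\mathrm{Ksdim}(R)=r\mid s$, where $r=\mathrm{Kdim}(R_0)$ and $s$ is the largest length of a system of odd parameters of $R$. Proposition. Let $X$ be an irreducible superscheme of finite type over a field $K$. If $U$ and $V$ are non-empty open affine super-subschemes of $X$, then $$\mathrm{Ksdim}(\mathcal O(U))=\mathrm{Ksdim}(\mathcal O(V)).$$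 Consequently the super-dimension $\mathrm{sdim}(X)$ is well defined: there is exactly one pair $r\mid s$ of natural numbers such that for every non-empty open affine super-subscheme $U$ of $X$ the super-ring $\mathcal O(U)$ is Noetherian, $\mathrm{Kdim}(\mathcal O(U)_0)=r$ is finite, the largest length of a system of odd parameters of $\mathcal O(U)$ exists and equals $s$, and thus $\mathrm{Ksdim}(\mathcal O(U))=r\mid s$. -/

import Mathlib

open CategoryTheory TopologicalSpace Opposite AlgebraicGeometry

universe v u

noncomputable section

/-! ### Super-commutative super-rings -/

/-- A super-commutative super-ring: a `ℤ/2`-graded ring `R = R₀ ⊕ R₁` with unit such that even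
elements commute with even and with odd elements, and odd elements have square zero. -/
structure SuperRing where
  carrier : Type u
  [ring : Ring carrier]
  grading : ZMod 2 → AddSubgroup carrier
  [gradedRing : GradedRing grading]
  even_mul_comm : ∀ r ∈ grading 0, ∀ s ∈ grading 0, r * s = s * r
  even_mul_odd_comm : ∀ r ∈ grading 0, ∀ s ∈ grading 1, r * s = s * r
  odd_mul_self : ∀ s ∈ grading 1, s * s = 0

namespace SuperRing

instance : CoeSort SuperRing.{u} (Type u) := ⟨SuperRing.carrier⟩

instance (R : SuperRing.{u}) : Ring R := R.ring

instance (R : SuperRing.{u}) : GradedRing R.grading := R.gradedRing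

/-- The category of super-commutative super-rings; morphisms are the graded ring
homomorphisms. -/
instance : Category SuperRing.{u} where
  Hom R S := R.grading →+*ᵍ S.grading
  id R := GradedRingHom.id R.grading
  comp f g := GradedRingHom.comp g f

/-- The functor forgetting the grading. -/
def forgetToRing : SuperRing.{u} ⥤ RingCat.{u} where
  obj R := RingCat.of R
  map f := RingCat.ofHom (GradedRingHom.toRingHom f)

/-- The even part `R₀`, as a subring of `R`. -/
def evenSubring (R : SuperRing.{u}) : Subring R where
  carrier := R.grading 0
  mul_mem' {a b} ha hb := by
    have h := SetLike.mul_mem_graded (A := R.grading) ha hb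
    rwa [add_zero] at h
  one_mem' := SetLike.one_mem_graded R.grading
  add_mem' := (R.grading 0).add_mem
  zero_mem' := (R.grading 0).zero_mem
  neg_mem' := (R.grading 0).neg_mem

/-- The even part `R₀`, which is a commutative ring. -/
abbrev Even (R : SuperRing.{u}) : Type u := R.evenSubring

instance (R : SuperRing.{u}) : CommRing R.Even where
  __ := (inferInstance : Ring R.Even)
  mul_comm a b := Subtype.ext (R.even_mul_comm a a.2 b b.2)

lemma exists_even_add_odd (R : SuperRing.{u}) (x : R) :
    ∃ a ∈ R.grading 0, ∃ b ∈ R.grading 1, x = a + b := by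
  classical
  refine ⟨_, (DirectSum.decompose R.grading x 0).2, _, (DirectSum.decompose R.grading x 1).2, ?_⟩
  exact (DirectSum.sum_support_decompose R.grading x).symm.trans
    ((Finset.sum_subset (Finset.subset_univ _) (by simp +contextual)).trans
      (Fin.sum_univ_two _))

lemma even_central (R : SuperRing.{u}) (a : R.Even) (x : R) : (a : R) * x = x * a := by
  obtain ⟨b, hb, c, hc, rfl⟩ := R.exists_even_add_odd x
  rw [mul_add, add_mul, R.even_mul_comm a a.2 b hb, R.even_mul_odd_comm a a.2 c hc]

instance (R : SuperRing.{u}) : Algebra R.Even R :=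
  R.evenSubring.subtype.toAlgebra' R.even_central

lemma even_smul_def (R : SuperRing.{u}) (a : R.Even) (x : R) : a • x = (a : R) * x := rfl

/-- The homomorphism `R₀ → S₀` induced by a morphism of super-rings. -/
def evenMap {R S : SuperRing.{u}} (f : R ⟶ S) : R.Even →+* S.Even :=
  (GradedRingHom.toRingHom f).restrict R.evenSubring S.evenSubring
    (fun _ hx => GradedRingHom.map_mem f hx)

/-! ### Krull super-dimension -/

/-- Noetherian super-rings: the ascending chain condition for super-ideals (graded ideals; by
super-commutativity, left super-ideals are two-sided). -/
def IsNoetherian (R : SuperRing.{u}) : Prop := WellFoundedGT (HomogeneousIdeal R.grading)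

/-- Odd elements `y₁, …, y_s` form a system of odd parameters if
`Kdim R₀ = Kdim (R₀ / Ann_{R₀}(y₁ ⋯ y_s))`. -/
def IsSystemOfOddParameters (R : SuperRing.{u}) {s : ℕ} (y : Fin s → R) : Prop :=
  (∀ i, y i ∈ R.grading 1) ∧
    ringKrullDim R.Even =
      ringKrullDim (R.Even ⧸ Ideal.torsionOf R.Even R (List.ofFn y).prod)

/-- The lengths of the systems of odd parameters. -/
def oddParameterLengths (R : SuperRing.{u}) : Set ℕ :=
  {s | ∃ y : Fin s → R, R.IsSystemOfOddParameters y}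

/-- The even Krull dimension, that is, the Krull dimension of `R₀`. -/
def Ksdim₀ (R : SuperRing.{u}) : WithBot ℕ∞ := ringKrullDim R.Even

/-- The odd Krull dimension: the largest length of a system of odd parameters. -/
def Ksdim₁ (R : SuperRing.{u}) : ℕ∞ := ⨆ s ∈ R.oddParameterLengths, (s : ℕ∞)

/-- The Krull super-dimension `Ksdim R = Ksdim₀ R | Ksdim₁ R`. -/
def Ksdim (R : SuperRing.{u}) : WithBot ℕ∞ × ℕ∞ := (R.Ksdim₀, R.Ksdim₁)

/-- The super-ring `R`, viewed as a `K`-superalgebra through `φ : K → R₀`, is finitely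
generated. -/
def IsFinitelyGenerated {K : Type v} [Field K] (R : SuperRing.{u}) (φ : K →+* R.Even) : Prop :=
  ∃ t : Finset R, Subring.closure (Set.range (fun k => (φ k : R)) ∪ t) = ⊤

/-! ### The structure sheaf of an affine superscheme -/

/-- A `ℤ/2`-grading by subgroups is obtained from projections onto its two components. -/
@[reducible]
def decompositionOfProj {M : Type u} [AddCommGroup M] (A : ZMod 2 → AddSubgroup M)
    (p : ZMod 2 → M → M) (hp : ∀ i m, p i m ∈ A i) (hsum : ∀ m, p 0 m + p 1 m = m)
    (hinj : ∀ a ∈ A 0, a ∈ A 1 → a = 0) :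
    DirectSum.Decomposition A := by
  refine DirectSum.IsInternal.chooseDecomposition A ⟨?_, ?_⟩
  · classical
    rw [injective_iff_map_eq_zero]
    intro x hx
    have hx' : (x 0 : M) + (x 1 : M) = 0 := by
      rw [← hx, DirectSum.coeAddMonoidHom_eq_dfinsuppSum, DFinsupp.sum_eq_sum_fintype]
      · exact (Fin.sum_univ_two (fun i : Fin 2 => (x (i : ZMod 2) : M))).symm
      · intro i; rfl
    have h0 : (x 0 : M) = 0 := by
      refine hinj _ (x 0).2 ?_
      rw [eq_neg_of_add_eq_zero_left hx']
      exact (A 1).neg_mem (x 1).2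
    have h1 : (x 1 : M) = 0 := by rwa [h0, zero_add] at hx'
    refine DFinsupp.ext fun i => ?_
    fin_cases i
    · exact Subtype.ext h0
    · exact Subtype.ext h1
  · intro m
    refine ⟨DirectSum.of (fun i => A i) 0 ⟨_, hp 0 m⟩ +
      DirectSum.of (fun i => A i) 1 ⟨_, hp 1 m⟩, ?_⟩
    rw [map_add, DirectSum.coeAddMonoidHom_of, DirectSum.coeAddMonoidHom_of]
    exact hsum m

/-- The projection of `R` onto its component of degree `i`. -/
def proj (R : SuperRing.{u}) (i : ZMod 2) : R →ₗ[R.Even] R where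
  toFun := GradedRing.proj R.grading i
  map_add' := map_add _
  map_smul' a x := by
    have h := DirectSum.coe_decompose_mul_of_left_mem_zero R.grading (j := i) (b := x) a.2
    simpa [even_smul_def, GradedRing.proj_apply] using h

lemma proj_mem (R : SuperRing.{u}) (i : ZMod 2) (x : R) : R.proj i x ∈ R.grading i :=
  (DirectSum.decompose R.grading x i).2

lemma proj_add (R : SuperRing.{u}) (x : R) : R.proj 0 x + R.proj 1 x = x := by
  obtain ⟨a, ha, b, hb, rfl⟩ := R.exists_even_add_odd x
  have h1 : R.proj 0 a = a := DirectSum.decompose_of_mem_same R.grading ha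
  have h2 : R.proj 0 b = 0 := DirectSum.decompose_of_mem_ne R.grading hb (by decide)
  have h3 : R.proj 1 a = 0 := DirectSum.decompose_of_mem_ne R.grading ha (by decide)
  have h4 : R.proj 1 b = b := DirectSum.decompose_of_mem_same R.grading hb
  rw [map_add, map_add, h1, h2, h3, h4, add_zero, zero_add]

lemma smul_mem_grading (R : SuperRing.{u}) {i : ZMod 2} (a : R.Even) {x : R}
    (hx : x ∈ R.grading i) : a • x ∈ R.grading i := by
  have h := SetLike.mul_mem_graded (A := R.grading) a.2 hx
  rwa [zero_add] at h

lemma eq_zero_of_even_of_odd (R : SuperRing.{u}) {x : R} (h0 : x ∈ R.grading 0)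
    (h1 : x ∈ R.grading 1) : x = 0 := by
  rw [← DirectSum.decompose_of_mem_same R.grading h0]
  exact DirectSum.decompose_of_mem_ne R.grading h1 (by decide)

/-- The component of degree `i` of the localization `S⁻¹R`, for a multiplicative subset `S` of
`R₀`: the fractions `r / s` with `r ∈ R_i`. -/
def localizedGrading (R : SuperRing.{u}) (S : Submonoid R.Even) (i : ZMod 2) :
    AddSubgroup (LocalizedModule S R) where
  carrier := {z | ∃ r ∈ R.grading i, ∃ s : S, z = LocalizedModule.mk r s}
  zero_mem' := ⟨0, zero_mem _, 1, (LocalizedModule.zero_mk 1).symm⟩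
  add_mem' := by
    rintro _ _ ⟨r, hr, s, rfl⟩ ⟨r', hr', s', rfl⟩
    exact ⟨_, add_mem (R.smul_mem_grading s' hr) (R.smul_mem_grading s hr'), _,
      LocalizedModule.mk_add_mk⟩
  neg_mem' := by
    rintro _ ⟨r, hr, s, rfl⟩
    exact ⟨-r, neg_mem hr, s, LocalizedModule.mk_neg.symm⟩

/-- The localization `R_𝔭 = (R₀ ∖ 𝔭₀)⁻¹ R` at the prime super-ideal `𝔭` with even part `p`. -/
abbrev AtPrime (R : SuperRing.{u}) (p : PrimeSpectrum R.Even) : Type u :=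
  LocalizedModule p.asIdeal.primeCompl R

/-- The underlying space of `SSpec R`. A prime super-ideal `𝔭` of `R` contains all odd elements,
so `𝔭 = 𝔭₀ ⊕ R₁` and `𝔭 ↦ 𝔭₀` is a homeomorphism onto the prime spectrum of `R₀`, where
the basic open sets are the `D(f)` for `f ∈ R₀`. -/
abbrev specTop (R : SuperRing.{u}) : TopCat.{u} := TopCat.of (PrimeSpectrum R.Even)

/-- A function `h` on `U` with values `h(𝔭) ∈ R_𝔭` is locally given by a fraction. -/
def IsLocallyFraction (R : SuperRing.{u}) {U : Opens R.specTop} (h : ∀ p : U, R.AtPrime p.1) :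
    Prop :=
  ∀ p : U, ∃ V : Opens R.specTop, p.1 ∈ V ∧ ∃ (r : R) (s : R.Even),
    ∀ q : U, q.1 ∈ V → ∃ hs : s ∉ q.1.asIdeal, h q = LocalizedModule.mk r ⟨s, hs⟩

/-- The functions `h` on `U` with `h(𝔭) ∈ R_𝔭` which are locally given by a fraction. -/
def specSections (R : SuperRing.{u}) (U : Opens R.specTop) :
    Subring (∀ p : U, R.AtPrime p.1) where
  carrier := {h | R.IsLocallyFraction h}
  zero_mem' p := ⟨⊤, trivial, 0, 1, fun q _ =>
    ⟨q.1.asIdeal.primeCompl.one_mem, (LocalizedModule.zero_mk _).symm⟩⟩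
  one_mem' p := ⟨⊤, trivial, 1, 1, fun q _ => ⟨q.1.asIdeal.primeCompl.one_mem, OreLocalization.one_def⟩⟩
  add_mem' := by
    intro a b ha hb p
    obtain ⟨V, hV, r, s, h⟩ := ha p
    obtain ⟨V', hV', r', s', h'⟩ := hb p
    refine ⟨V ⊓ V', ⟨hV, hV'⟩, s' • r + s • r', s * s', fun q hq => ?_⟩
    obtain ⟨hs, e⟩ := h q hq.1
    obtain ⟨hs', e'⟩ := h' q hq.2
    exact ⟨q.1.asIdeal.primeCompl.mul_mem hs hs',
      (congrArg₂ (· + ·) e e').trans LocalizedModule.mk_add_mk⟩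
  mul_mem' := by
    intro a b ha hb p
    obtain ⟨V, hV, r, s, h⟩ := ha p
    obtain ⟨V', hV', r', s', h'⟩ := hb p
    refine ⟨V ⊓ V', ⟨hV, hV'⟩, r * r', s * s', fun q hq => ?_⟩
    obtain ⟨hs, e⟩ := h q hq.1
    obtain ⟨hs', e'⟩ := h' q hq.2
    exact ⟨q.1.asIdeal.primeCompl.mul_mem hs hs',
      (congrArg₂ (· * ·) e e').trans LocalizedModule.mk_mul_mk⟩
  neg_mem' := by
    intro a ha p
    obtain ⟨V, hV, r, s, h⟩ := ha p
    refine ⟨V, hV, -r, s, fun q hq => ?_⟩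
    obtain ⟨hs, e⟩ := h q hq
    exact ⟨hs, (congrArg Neg.neg e).trans LocalizedModule.mk_neg.symm⟩

lemma specSections_isLocallyFraction (R : SuperRing.{u}) {U : Opens R.specTop}
    (h : R.specSections U) : R.IsLocallyFraction h.1 := h.2

/-- A section is homogeneous of degree `i` if all its values are. -/
def specGrading (R : SuperRing.{u}) (U : Opens R.specTop) (i : ZMod 2) :
    AddSubgroup (R.specSections U) where
  carrier := {h | ∀ p : U, h.1 p ∈ R.localizedGrading p.1.asIdeal.primeCompl i}
  zero_mem' _ := zero_mem _
  add_mem' ha hb p := add_mem (ha p) (hb p)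
  neg_mem' ha p := neg_mem (ha p)

lemma localizedGrading_mul_mem (R : SuperRing.{u}) (S : Submonoid R.Even) {i j : ZMod 2}
    {a b : LocalizedModule S R} (ha : a ∈ R.localizedGrading S i)
    (hb : b ∈ R.localizedGrading S j) : a * b ∈ R.localizedGrading S (i + j) := by
  obtain ⟨r, hr, s, rfl⟩ := ha
  obtain ⟨r', hr', s', rfl⟩ := hb
  exact ⟨r * r', SetLike.mul_mem_graded hr hr', s * s', LocalizedModule.mk_mul_mk⟩

lemma localizedGrading_inter (R : SuperRing.{u}) (S : Submonoid R.Even)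
    {a : LocalizedModule S R} (h0 : a ∈ R.localizedGrading S 0)
    (h1 : a ∈ R.localizedGrading S 1) : a = 0 := by
  obtain ⟨r, hr, s, rfl⟩ := h0
  obtain ⟨r', hr', s', e⟩ := h1
  obtain ⟨w, hw⟩ := LocalizedModule.mk_eq.mp e
  have hz : w • s' • r = 0 := by
    refine R.eq_zero_of_even_of_odd (R.smul_mem_grading w (R.smul_mem_grading s' hr)) ?_
    rw [hw]
    exact R.smul_mem_grading w (R.smul_mem_grading s hr')
  rw [← LocalizedModule.zero_mk s', LocalizedModule.mk_eq]
  exact ⟨w, by rw [hz, smul_zero, smul_zero]⟩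

/-- The component of degree `i` of a section. -/
def specProj (R : SuperRing.{u}) (U : Opens R.specTop) (i : ZMod 2) (h : R.specSections U) :
    R.specSections U :=
  ⟨fun p => LocalizedModule.map p.1.asIdeal.primeCompl (R.proj i) (h.1 p), fun p => by
    obtain ⟨V, hV, r, s, e⟩ := R.specSections_isLocallyFraction h p
    refine ⟨V, hV, R.proj i r, s, fun q hq => ?_⟩
    obtain ⟨hs, e⟩ := e q hq
    exact ⟨hs, (congrArg (LocalizedModule.map q.1.asIdeal.primeCompl (R.proj i)) e).trans
      (LocalizedModule.map_mk _ _ _ _)⟩⟩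

instance (R : SuperRing.{u}) (U : Opens R.specTop) : GradedRing (R.specGrading U) where
  one_mem _ := ⟨1, SetLike.one_mem_graded _, 1, OreLocalization.one_def⟩
  mul_mem _ _ _ _ ha hb p := R.localizedGrading_mul_mem _ (ha p) (hb p)
  toDecomposition := decompositionOfProj _ (R.specProj U)
    (by
      intro i h p
      obtain ⟨V, hV, r, s, e⟩ := R.specSections_isLocallyFraction h p
      obtain ⟨hs, e⟩ := e p hV
      refine ⟨R.proj i r, R.proj_mem i r, ⟨s, hs⟩, ?_⟩
      simp only [specProj]
      rw [e, LocalizedModule.map_mk])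
    (by
      intro h
      refine Subtype.ext (funext fun p => ?_)
      obtain ⟨V, hV, r, s, e⟩ := R.specSections_isLocallyFraction h p
      obtain ⟨hs, e⟩ := e p hV
      simp only [specProj, Subring.coe_add, Pi.add_apply]
      rw [e, LocalizedModule.map_mk, LocalizedModule.map_mk, LocalizedModule.mk_add_mk,
        ← smul_add, proj_add, LocalizedModule.mk_cancel_common_left])
    (fun a h0 h1 => Subtype.ext (funext fun p => R.localizedGrading_inter _ (h0 p) (h1 p)))

lemma localizedGrading_comm (R : SuperRing.{u}) (S : Submonoid R.Even) {i : ZMod 2}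
    {a b : LocalizedModule S R} (ha : a ∈ R.localizedGrading S 0)
    (hb : b ∈ R.localizedGrading S i) : a * b = b * a := by
  obtain ⟨r, hr, s, rfl⟩ := ha
  obtain ⟨r', hr', s', rfl⟩ := hb
  rw [LocalizedModule.mk_mul_mk, LocalizedModule.mk_mul_mk, mul_comm s s',
    R.even_central ⟨r, hr⟩ r']

/-- The super-ring of sections of the structure sheaf of `SSpec R` over `U`. -/
def specSuperRing (R : SuperRing.{u}) (U : Opens R.specTop) : SuperRing.{u} where
  carrier := R.specSections U
  grading := R.specGrading U
  even_mul_comm a ha b hb :=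
    Subtype.ext (funext fun p => R.localizedGrading_comm _ (ha p) (hb p))
  even_mul_odd_comm a ha b hb :=
    Subtype.ext (funext fun p => R.localizedGrading_comm _ (ha p) (hb p))
  odd_mul_self a ha := by
    refine Subtype.ext (funext fun p => ?_)
    obtain ⟨r, hr, s, e⟩ := ha p
    change a.1 p * a.1 p = 0
    rw [e, LocalizedModule.mk_mul_mk, R.odd_mul_self r hr, LocalizedModule.zero_mk]

/-- The restriction map for sections of the structure sheaf of `SSpec R`. -/
def specRes (R : SuperRing.{u}) {U V : Opens R.specTop} (hVU : V ≤ U) :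
    R.specSuperRing U ⟶ R.specSuperRing V where
  toFun h := ⟨fun p => h.1 ⟨p.1, hVU p.2⟩, fun p => by
    obtain ⟨W, hW, r, s, e⟩ := R.specSections_isLocallyFraction h ⟨p.1, hVU p.2⟩
    exact ⟨W, hW, r, s, fun q hq => e ⟨q.1, hVU q.2⟩ hq⟩⟩
  map_one' := rfl
  map_mul' _ _ := rfl
  map_zero' := rfl
  map_add' _ _ := rfl
  map_mem h p := h ⟨p.1, hVU p.2⟩

/-- The structure presheaf of `SSpec R`. -/
def specPresheaf (R : SuperRing.{u}) : TopCat.Presheaf SuperRing.{u} R.specTop where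
  obj U := R.specSuperRing U.unop
  map f := R.specRes (leOfHom f.unop)
  map_id _ := rfl
  map_comp _ _ := rfl

lemma specPresheaf_isSheaf (R : SuperRing.{u}) : R.specPresheaf.IsSheaf := by
  intro E U S hS x hx
  have hS' : ∀ p : U, ∃ (V : Opens R.specTop) (f : V ⟶ U), S f ∧ p.1 ∈ V :=
    fun p => hS p.1 p.2
  choose W f hf hW using hS'
  let y : ∀ {V : Opens R.specTop} (g : V ⟶ U), S g →
      (E.grading →+*ᵍ (R.specSuperRing V).grading) := fun g hg => x g hg
  have key : ∀ {V : Opens R.specTop} (g : V ⟶ U) (hg : S g) (p : U) (hp : p.1 ∈ V) (e : E),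
      (y (f p) (hf p) e).1 ⟨p.1, hW p⟩ =
        (y g hg e).1 ⟨p.1, hp⟩ := by
    intro V g hg p hp e
    have h := hx (homOfLE inf_le_left : W p ⊓ V ⟶ W p) (homOfLE inf_le_right) (hf p) hg
      (Subsingleton.elim _ _)
    exact congrArg (fun k : E.grading →+*ᵍ (R.specSuperRing (W p ⊓ V)).grading =>
      (k e).1 ⟨p.1, hW p, hp⟩) h
  let t : E.grading →+*ᵍ (R.specSuperRing U).grading :=
    { toFun := fun e => ⟨fun p =>
        (y (f p) (hf p) e).1 ⟨p.1, hW p⟩, by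
        intro p
        obtain ⟨V, hV, r, s, h⟩ := R.specSections_isLocallyFraction
          (y (f p) (hf p) e) ⟨p.1, hW p⟩
        refine ⟨V ⊓ W p, ⟨hV, hW p⟩, r, s, fun q hq => ?_⟩
        obtain ⟨hs, h⟩ := h ⟨q.1, hq.2⟩ hq.1
        exact ⟨hs, (key (f p) (hf p) q hq.2 e).trans h⟩⟩
      map_one' := Subtype.ext (funext fun p => congrArg (fun z => z.1 ⟨p.1, hW p⟩)
        (GradedRingHom.map_one (y (f p) (hf p))))
      map_mul' := fun a b => Subtype.ext (funext fun p => congrArg (fun z => z.1 ⟨p.1, hW p⟩)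
        (GradedRingHom.map_mul (y (f p) (hf p)) a b))
      map_zero' := Subtype.ext (funext fun p => congrArg (fun z => z.1 ⟨p.1, hW p⟩)
        (GradedRingHom.map_zero (y (f p) (hf p))))
      map_add' := fun a b => Subtype.ext (funext fun p => congrArg (fun z => z.1 ⟨p.1, hW p⟩)
        (GradedRingHom.map_add (y (f p) (hf p)) a b))
      map_mem := fun {i e} he p => GradedRingHom.map_mem (y (f p) (hf p)) he ⟨p.1, hW p⟩ }
  refine ⟨t, ?_, ?_⟩
  · intro V g hg
    refine GradedRingHom.ext fun e => Subtype.ext (funext fun p => ?_)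
    exact key g hg ⟨p.1, leOfHom g p.2⟩ p.2 e
  · intro t' ht'
    refine GradedRingHom.ext fun e => Subtype.ext (funext fun p => ?_)
    exact congrArg (fun k : E.grading →+*ᵍ (R.specSuperRing (W p)).grading =>
      (k e).1 ⟨p.1, hW p⟩) (ht' (f p) (hf p))

end SuperRing

/-! ### Superschemes -/

/-- The affine superscheme `SSpec R`, as a space with a sheaf of super-rings. -/
def SSpec (R : SuperRing.{u}) : SheafedSpace.{u + 1, u, u} SuperRing.{u} where
  carrier := R.specTop
  presheaf := R.specPresheaf
  IsSheaf := R.specPresheaf_isSheaf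

/-- A geometric superspace: a topological space with a sheaf of super-commutative super-rings all
of whose stalks are local. (A super-commutative super-ring has a unique maximal super-ideal if and
only if it is local as a ring.) -/
structure GeometricSuperspace extends SheafedSpace.{u + 1, u, u} SuperRing.{u} where
  isLocalRing_stalk : ∀ x : carrier,
    IsLocalRing (TopCat.Presheaf.stalk (C := RingCat.{u}) (presheaf ⋙ SuperRing.forgetToRing) x)

namespace GeometricSuperspace

/-- The super-ring of sections `𝒪(U)`. -/
abbrev sections (X : GeometricSuperspace.{u}) (U : Opens X.carrier) : SuperRing.{u} :=
  X.presheaf.obj (op U)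

/-- The open super-subspace `(U, 𝒪|_U)` is isomorphic to `SSpec R` for some super-ring `R`.
(An isomorphism of spaces with sheaves of super-rings induces isomorphisms, hence local
morphisms, on the stalks.) -/
def IsAffineOpen (X : GeometricSuperspace.{u}) (U : Opens X.carrier) : Prop :=
  ∃ R : SuperRing.{u}, Nonempty (X.toSheafedSpace.restrict U.isOpenEmbedding ≅ SSpec R)

end GeometricSuperspace

/-- A superscheme: a geometric superspace which is covered by open affine super-subspaces. -/
structure Superscheme extends GeometricSuperspace.{u} where
  exists_isAffineOpen : ∀ x : carrier,
    ∃ U : Opens carrier, x ∈ U ∧ toGeometricSuperspace.IsAffineOpen U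

namespace Superscheme

/-- A structure of superscheme over a field `K`, that is, a morphism to the spectrum of `K`, given
as a homomorphism from `K` to the even global sections. It makes `𝒪` a sheaf of
`K`-superalgebras. -/
abbrev StructureMap (X : Superscheme.{u}) (K : Type v) [Field K] : Type (max v u) :=
  K →+* (X.sections ⊤).Even

/-- The `K`-superalgebra structure of `𝒪(U)`. -/
def structureMapOn (X : Superscheme.{u}) {K : Type v} [Field K] (φ : X.StructureMap K)
    (U : Opens X.carrier) : K →+* (X.sections U).Even :=
  (SuperRing.evenMap (X.presheaf.map (homOfLE le_top : U ⟶ ⊤).op)).comp φ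

/-- `X` is of finite type over `K`: it has a finite covering by open affine super-subschemes whose
super-rings of sections are finitely generated `K`-superalgebras. -/
def IsOfFiniteType (X : Superscheme.{u}) {K : Type v} [Field K] (φ : X.StructureMap K) : Prop :=
  ∃ (n : ℕ) (U : Fin n → Opens X.carrier), (⨆ i, U i) = ⊤ ∧
    ∀ i, X.IsAffineOpen (U i) ∧ (X.sections (U i)).IsFinitelyGenerated (X.structureMapOn φ (U i))

end Superscheme

end

/-!
Two non-empty affine opens of an irreducible superscheme meet, and around a common point they share
an open set that is basic in both; so it suffices that `Ksdim` does not change when the super-ring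
`R` of an affine open is localized at a non-nilpotent even element. The nilradical of `R₀` is prime
and `R₀` is of finite type over `K`, so `Kdim R₀` survives localization because it is the
transcendence degree of the fraction field of `R₀` modulo its nilradical. By dimension theory,
`Kdim (R₀ / I) = Kdim R₀` if and only if `I` lies in the nilradical, so `y₁, …, y_s` are odd
parameters exactly when `Ann (y₁ ⋯ y_s)` is contained in the nilradical, a condition that
localization preserves and reflects. The lengths are bounded because `R` is a finite `R₀`-module:
a product of more odd elements than there are odd generators is a combination of products in which
a generator is repeated, hence vanishes.
-/

section KrullDimension

lemma ringKrullDim_eq_of_isIntegral {A B : Type*} [CommRing A] [CommRing B] [Algebra A B]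
    [Algebra.IsIntegral A B] (hinj : Function.Injective (algebraMap A B)) :
    ringKrullDim B = ringKrullDim A := by
  apply le_antisymm
  · exact Order.krullDim_le_of_strictMono (PrimeSpectrum.comap (algebraMap A B)) fun p q hpq ↦
      Ideal.IsIntegral.comap_lt_comap (R := A) (I := p.asIdeal) (J := q.asIdeal) hpq
  · refine iSup_le fun l ↦ ?_
    obtain ⟨Q, -, _, hQ⟩ := Ideal.exists_ideal_over_prime_of_isIntegral l.head.asIdeal
      (⊥ : Ideal B) (by
        rw [← RingHom.ker_eq_comap_bot, (RingHom.injective_iff_ker_eq_bot _).mp hinj]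
        exact bot_le)
    have : Q.LiesOver l.head.asIdeal := ⟨hQ.symm⟩
    obtain ⟨L, hL, -⟩ := Ideal.exists_ltSeries_of_hasGoingUp l Q
    exact hL ▸ Order.LTSeries.length_le_krullDim L

section NoetherNormalization

variable {K A : Type*} [Field K] [CommRing A] [Algebra K A] {n : ℕ}
  {g : MvPolynomial (Fin n) K →ₐ[K] A}

lemma ringKrullDim_eq_of_isIntegral_mvPolynomial (hg : Function.Injective g)
    (hint : g.IsIntegral) : ringKrullDim A = n := by
  let _ := g.toRingHom.toAlgebra
  have : Algebra.IsIntegral (MvPolynomial (Fin n) K) A := ⟨hint⟩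
  rw [ringKrullDim_eq_of_isIntegral (A := MvPolynomial (Fin n) K) hg,
    MvPolynomial.ringKrullDim_of_isNoetherianRing]
  simp

lemma trdeg_eq_of_isIntegral_mvPolynomial [IsDomain A] (hg : Function.Injective g)
    (hint : g.IsIntegral) : Algebra.trdeg K A = n := by
  let _ := g.toRingHom.toAlgebra
  have : Algebra.IsIntegral (MvPolynomial (Fin n) K) A := ⟨hint⟩
  have : IsScalarTower K (MvPolynomial (Fin n) K) A :=
    IsScalarTower.of_algebraMap_eq fun x ↦ (g.commutes x).symm
  have : FaithfulSMul (MvPolynomial (Fin n) K) A :=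
    (faithfulSMul_iff_algebraMap_injective _ _).mpr hg
  have h := lift_trdeg_add_eq K (MvPolynomial (Fin n) K) A
  rw [trdeg_eq_zero (R := MvPolynomial (Fin n) K), MvPolynomial.trdeg_of_isDomain] at h
  simpa using h.symm

end NoetherNormalization

section FiniteType

variable (K A : Type*) [Field K] [CommRing A] [Algebra K A] [Algebra.FiniteType K A]

include K in
lemma finiteRingKrullDim_of_finiteType [Nontrivial A] : FiniteRingKrullDim A := by
  obtain ⟨n, g, hg, hint⟩ := exists_integral_inj_algHom_of_fg K A
  have hdim := ringKrullDim_eq_of_isIntegral_mvPolynomial hg hint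
  rw [finiteRingKrullDim_iff_ne_bot_and_top, hdim]
  exact ⟨WithBot.natCast_ne_bot n, fun h ↦ ENat.natCast_ne_top n (WithBot.coe_injective h)⟩

lemma exists_ringKrullDim_eq_and_trdeg_eq [IsDomain A] :
    ∃ n : ℕ, ringKrullDim A = n ∧ Algebra.trdeg K A = n := by
  obtain ⟨n, g, hg, hint⟩ := exists_integral_inj_algHom_of_fg K A
  exact ⟨n, ringKrullDim_eq_of_isIntegral_mvPolynomial hg hint,
    trdeg_eq_of_isIntegral_mvPolynomial hg hint⟩

end FiniteType

lemma map_nilradical_le {A B : Type*} [CommRing A] [CommRing B] (g : A →+* B) :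
    (nilradical A).map g ≤ nilradical B :=
  Ideal.map_le_iff_le_comap.mpr fun _ ha ↦ IsNilpotent.map ha g

section Quotient

variable {A : Type*} [CommRing A] {I : Ideal A}

lemma ringKrullDim_quotient_of_le_nilradical (hI : I ≤ nilradical A) :
    ringKrullDim (A ⧸ I) = ringKrullDim A := by
  rw [ringKrullDim_quotient, (PrimeSpectrum.zeroLocus_eq_univ_iff _).mpr hI]
  exact Order.krullDim_eq_of_orderIso OrderIso.Set.univ

variable (A) in
lemma exists_ringKrullDim_eq_natCast [FiniteRingKrullDim A] : ∃ n : ℕ, ringKrullDim A = n :=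
  ⟨_, Order.krullDim_eq_length_of_finiteDimensionalOrder⟩

lemma ringKrullDim_quotient_lt_of_ne_bot [IsDomain A] [FiniteRingKrullDim A] (hI : I ≠ ⊥) :
    ringKrullDim (A ⧸ I) < ringKrullDim A := by
  obtain ⟨a, haI, ha⟩ := I.ne_bot_iff.mp hI
  have hsucc : ringKrullDim (A ⧸ I) + 1 ≤ ringKrullDim A :=
    ringKrullDim_succ_le_of_surjective _ Ideal.Quotient.mk_surjective
      (mem_nonZeroDivisors_of_ne_zero ha) (Ideal.Quotient.eq_zero_iff_mem.mpr haI)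
  obtain ⟨n, hn⟩ := exists_ringKrullDim_eq_natCast A
  rw [hn] at hsucc ⊢
  by_contra! hle
  exact lt_irrefl _ (ENat.WithBot.add_one_le_iff.mp ((add_le_add_left hle 1).trans hsucc))

lemma ringKrullDim_quotient_lt_of_not_le_nilradical [FiniteRingKrullDim A]
    (hN : (nilradical A).IsPrime) (hI : ¬ I ≤ nilradical A) :
    ringKrullDim (A ⧸ I) < ringKrullDim A := by
  let N := nilradical A
  have hNA : ringKrullDim (A ⧸ N) = ringKrullDim A := ringKrullDim_quotient_of_le_nilradical le_rfl
  have : FiniteRingKrullDim (A ⧸ N) := by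
    rwa [finiteRingKrullDim_iff_ne_bot_and_top, hNA, ← finiteRingKrullDim_iff_ne_bot_and_top]
  have hIN : I.map (Ideal.Quotient.mk N) ≠ ⊥ := by
    rwa [Ne, Ideal.map_eq_bot_iff_le_ker, Ideal.mk_ker]
  calc ringKrullDim (A ⧸ I)
      = ringKrullDim ((A ⧸ I) ⧸ N.map (Ideal.Quotient.mk I)) :=
        (ringKrullDim_quotient_of_le_nilradical (map_nilradical_le _)).symm
    _ = ringKrullDim ((A ⧸ N) ⧸ I.map (Ideal.Quotient.mk N)) :=
        ringKrullDim_eq_of_ringEquiv (DoubleQuot.quotQuotEquivComm I N)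
    _ < ringKrullDim (A ⧸ N) := ringKrullDim_quotient_lt_of_ne_bot hIN
    _ = ringKrullDim A := hNA

lemma ringKrullDim_eq_ringKrullDim_quotient_iff [FiniteRingKrullDim A]
    (hN : (nilradical A).IsPrime) :
    ringKrullDim A = ringKrullDim (A ⧸ I) ↔ I ≤ nilradical A :=
  ⟨fun h ↦ by_contra fun hI ↦ (ringKrullDim_quotient_lt_of_not_le_nilradical hN hI).ne' h,
    fun hI ↦ (ringKrullDim_quotient_of_le_nilradical hI).symm⟩

end Quotient

section Localization

lemma ringKrullDim_eq_of_isLocalizationAway_of_isDomain (K : Type*) {A B : Type*} [Field K]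
    [CommRing A] [IsDomain A] [Algebra K A] [Algebra.FiniteType K A] [CommRing B] [Algebra A B]
    {f : A} (hf : f ≠ 0) [IsLocalization.Away f B] : ringKrullDim B = ringKrullDim A := by
  let _ : Algebra K B := ((algebraMap A B).comp (algebraMap K A)).toAlgebra
  have : IsScalarTower K A B := IsScalarTower.of_algebraMap_eq' rfl
  have hle : Submonoid.powers f ≤ nonZeroDivisors A :=
    powers_le_nonZeroDivisors_of_noZeroDivisors hf
  have : IsDomain B := IsLocalization.isDomain_of_le_nonZeroDivisors (M := Submonoid.powers f) B hle
  have : Algebra.FiniteType A B := IsLocalization.finiteType_of_monoid_fg (Submonoid.powers f) B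
  have : Algebra.FiniteType K B := Algebra.FiniteType.trans (S := A) ‹_› ‹_›
  have : FaithfulSMul A B :=
    (faithfulSMul_iff_algebraMap_injective A B).mpr (IsLocalization.injective B hle)
  have : Algebra.IsAlgebraic A B := IsLocalization.isAlgebraic B (Submonoid.powers f)
  obtain ⟨n, hdimA, htrA⟩ := exists_ringKrullDim_eq_and_trdeg_eq K A
  obtain ⟨m, hdimB, htrB⟩ := exists_ringKrullDim_eq_and_trdeg_eq K B
  have htr := lift_trdeg_add_eq K A B
  rw [trdeg_eq_zero (R := A), htrA, htrB] at htr
  rw [hdimA, hdimB, Nat.cast_inj]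
  simpa using htr.symm

variable {A B : Type*} [CommRing A] [CommRing B] [Algebra A B] {f : A} [IsLocalization.Away f B]

lemma disjoint_powers_nilradical (hN : (nilradical A).IsPrime) (hf : f ∉ nilradical A) :
    Disjoint (Submonoid.powers f : Set A) (nilradical A) := by
  rw [Set.disjoint_left]
  rintro _ ⟨n, rfl⟩ hn
  exact hf (hN.mem_of_pow_mem n hn)

variable (B) in
lemma isPrime_map_nilradical_of_isLocalizationAway (hN : (nilradical A).IsPrime)
    (hf : f ∉ nilradical A) : ((nilradical A).map (algebraMap A B)).IsPrime :=
  IsLocalization.isPrime_of_isPrime_disjoint _ B _ hN (disjoint_powers_nilradical hN hf)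

variable (B) in
lemma map_nilradical_of_isLocalizationAway (hN : (nilradical A).IsPrime)
    (hf : f ∉ nilradical A) : (nilradical A).map (algebraMap A B) = nilradical B :=
  have := isPrime_map_nilradical_of_isLocalizationAway B hN hf
  le_antisymm (map_nilradical_le (algebraMap A B)) (nilradical_le_prime _)

variable (B) in
lemma isPrime_nilradical_of_isLocalizationAway (hN : (nilradical A).IsPrime)
    (hf : f ∉ nilradical A) : (nilradical B).IsPrime :=
  map_nilradical_of_isLocalizationAway B hN hf ▸
    isPrime_map_nilradical_of_isLocalizationAway B hN hf

lemma algebraMap_mem_nilradical_iff_of_isLocalizationAway (hN : (nilradical A).IsPrime)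
    (hf : f ∉ nilradical A) {a : A} : algebraMap A B a ∈ nilradical B ↔ a ∈ nilradical A := by
  rw [← map_nilradical_of_isLocalizationAway B hN hf, ← Ideal.mem_comap, ← Ideal.under_def,
    IsLocalization.under_map_of_isPrime_disjoint _ B hN (disjoint_powers_nilradical hN hf)]

lemma ringKrullDim_eq_of_isLocalizationAway (K : Type*) [Field K] [Algebra K A]
    [Algebra.FiniteType K A] (hN : (nilradical A).IsPrime) (hf : f ∉ nilradical A) :
    ringKrullDim B = ringKrullDim A := by
  let N := nilradical A
  have : IsLocalization.Away (Ideal.Quotient.mk N f) (B ⧸ N.map (algebraMap A B)) := by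
    have h : IsLocalization (Algebra.algebraMapSubmonoid (A ⧸ N) (Submonoid.powers f))
      (B ⧸ N.map (algebraMap A B)) := inferInstance
    rwa [Algebra.algebraMapSubmonoid_powers] at h
  calc ringKrullDim B
      = ringKrullDim (B ⧸ N.map (algebraMap A B)) :=
        (ringKrullDim_quotient_of_le_nilradical (map_nilradical_le (algebraMap A B))).symm
    _ = ringKrullDim (A ⧸ N) :=
        ringKrullDim_eq_of_isLocalizationAway_of_isDomain K (f := Ideal.Quotient.mk N f)
          (by rwa [Ne, Ideal.Quotient.eq_zero_iff_mem])
    _ = ringKrullDim A := ringKrullDim_quotient_of_le_nilradical le_rfl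

end Localization

end KrullDimension

noncomputable section

namespace SuperRing

variable {R S T : SuperRing.{u}}

section Morphisms

/-- The ring homomorphism underlying a morphism of super-rings. -/
abbrev ringHom (ρ : R ⟶ S) : R →+* S := GradedRingHom.toRingHom ρ

lemma ringHom_mem (ρ : R ⟶ S) {i : ZMod 2} {x : R} (hx : x ∈ R.grading i) :
    ringHom ρ x ∈ S.grading i :=
  GradedRingHom.map_mem ρ hx

lemma coe_evenMap (ρ : R ⟶ S) (a : R.Even) : (evenMap ρ a : S) = ringHom ρ a := rfl

lemma ringHom_comp (ρ : R ⟶ S) (σ : S ⟶ T) : ringHom (ρ ≫ σ) = (ringHom σ).comp (ringHom ρ) :=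
  rfl

lemma evenMap_comp (ρ : R ⟶ S) (σ : S ⟶ T) : evenMap (ρ ≫ σ) = (evenMap σ).comp (evenMap ρ) :=
  rfl

lemma ringHom_smul (ρ : R ⟶ S) (a : R.Even) (x : R) :
    ringHom ρ (a • x) = evenMap ρ a • ringHom ρ x := by
  rw [even_smul_def, even_smul_def, map_mul, coe_evenMap]

lemma proj_of_mem {i : ZMod 2} {x : R} (hx : x ∈ R.grading i) : R.proj i x = x :=
  DirectSum.decompose_of_mem_same R.grading hx

lemma ringHom_proj (ρ : R ⟶ S) (i : ZMod 2) (x : R) :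
    ringHom ρ (R.proj i x) = S.proj i (ringHom ρ x) :=
  GradedRingHom.map_directSumDecompose R.grading S.grading ρ

lemma ringHom_bijective (ρ : R ⟶ S) [IsIso ρ] : Function.Bijective (ringHom ρ) := by
  refine Function.bijective_iff_has_inverse.mpr ⟨ringHom (inv ρ), fun x ↦ ?_, fun x ↦ ?_⟩
  · rw [← RingHom.comp_apply, ← ringHom_comp, IsIso.hom_inv_id]
    rfl
  · rw [← RingHom.comp_apply, ← ringHom_comp, IsIso.inv_hom_id]
    rfl

lemma evenMap_bijective {ρ : R ⟶ S} (hρ : Function.Bijective (ringHom ρ)) :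
    Function.Bijective (evenMap ρ) := by
  refine ⟨fun a b h ↦ Subtype.ext (hρ.1 (congrArg Subtype.val h)), fun b ↦ ?_⟩
  obtain ⟨x, hx⟩ := hρ.2 b
  have hx₀ : R.proj 0 x = x := hρ.1 (by rw [ringHom_proj, hx, proj_of_mem b.2])
  exact ⟨⟨x, hx₀ ▸ R.proj_mem 0 x⟩, Subtype.ext hx⟩

end Morphisms

section IsAway

/-- The morphism of super-rings `ρ : R ⟶ S` exhibits `S` as the localization of `R` away from the
even element `f`, that is, as the localization at the powers of `f` of the `R₀`-module `R`. -/
structure IsAway (ρ : R ⟶ S) (f : R.Even) : Prop where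
  isUnit : IsUnit (evenMap ρ f)
  surj : ∀ y : S, ∃ (n : ℕ) (x : R), evenMap ρ f ^ n • y = ringHom ρ x
  exists_pow_smul_eq_zero : ∀ x : R, ringHom ρ x = 0 → ∃ n : ℕ, f ^ n • x = 0

namespace IsAway

variable {ρ : R ⟶ S} {f : R.Even}

lemma surj_of_mem (h : IsAway ρ f) {i : ZMod 2} {y : S} (hy : y ∈ S.grading i) :
    ∃ n : ℕ, ∃ x ∈ R.grading i, evenMap ρ f ^ n • y = ringHom ρ x := by
  obtain ⟨n, x, hx⟩ := h.surj y
  refine ⟨n, R.proj i x, R.proj_mem i x, ?_⟩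
  rw [ringHom_proj, ← hx, proj_of_mem (S.smul_mem_grading _ hy)]

lemma surj_even (h : IsAway ρ f) (b : S.Even) :
    ∃ (n : ℕ) (a : R.Even), evenMap ρ f ^ n * b = evenMap ρ a := by
  obtain ⟨n, x, hx, e⟩ := h.surj_of_mem b.2
  exact ⟨n, ⟨x, hx⟩, Subtype.ext e⟩

lemma exists_pow_smul_eq_pow_smul (h : IsAway ρ f) {x y : R} (hxy : ringHom ρ x = ringHom ρ y) :
    ∃ n : ℕ, f ^ n • x = f ^ n • y := by
  obtain ⟨n, hn⟩ := h.exists_pow_smul_eq_zero (x - y) (by rw [map_sub, hxy, sub_self])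
  exact ⟨n, by rwa [smul_sub, sub_eq_zero] at hn⟩

lemma exists_pow_mul_eq_pow_mul (h : IsAway ρ f) {a b : R.Even} (hab : evenMap ρ a = evenMap ρ b) :
    ∃ n : ℕ, f ^ n * a = f ^ n * b := by
  obtain ⟨n, hn⟩ := h.exists_pow_smul_eq_pow_smul (congrArg Subtype.val hab)
  exact ⟨n, Subtype.ext hn⟩

lemma isLocalization (h : IsAway ρ f) :
    @IsLocalization.Away _ _ f S.Even _ (evenMap ρ).toAlgebra := by
  let _ := (evenMap ρ).toAlgebra
  refine .mk f h.isUnit (fun b ↦ ?_) fun _ _ ↦ h.exists_pow_mul_eq_pow_mul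
  obtain ⟨n, a, hab⟩ := h.surj_even b
  exact ⟨n, a, by rwa [mul_comm]⟩

lemma exists_dvd_pow (h : IsAway ρ f) {a : R.Even} (ha : IsUnit (evenMap ρ a)) :
    ∃ n : ℕ, a ∣ f ^ n := by
  obtain ⟨b, hab⟩ := ha.exists_right_inv
  obtain ⟨n, c, hbc⟩ := h.surj_even b
  have hac : evenMap ρ (a * c) = evenMap ρ (f ^ n) := by
    rw [map_mul, ← hbc, mul_left_comm, hab, mul_one, map_pow]
  obtain ⟨m, hm⟩ := h.exists_pow_mul_eq_pow_mul hac
  exact ⟨m + n, f ^ m * c, by rw [pow_add, ← hm, mul_left_comm]⟩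

lemma bijective_of_one (h : IsAway ρ 1) : Function.Bijective (ringHom ρ) := by
  refine ⟨(injective_iff_map_eq_zero _).mpr fun x hx ↦ ?_, fun y ↦ ?_⟩
  · obtain ⟨n, hn⟩ := h.exists_pow_smul_eq_zero x hx
    rwa [one_pow, one_smul] at hn
  · obtain ⟨n, x, hx⟩ := h.surj y
    exact ⟨x, by rw [← hx, map_one, one_pow, one_smul]⟩

lemma comp_bijective (h : IsAway ρ f) {σ : S ⟶ T} (hσ : Function.Bijective (ringHom σ)) :
    IsAway (ρ ≫ σ) f where
  isUnit := h.isUnit.map (evenMap σ)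
  surj y := by
    obtain ⟨y, rfl⟩ := hσ.2 y
    obtain ⟨n, x, hx⟩ := h.surj y
    exact ⟨n, x, by rw [evenMap_comp, ringHom_comp, RingHom.comp_apply, RingHom.comp_apply, ← hx,
      ringHom_smul, map_pow]⟩
  exists_pow_smul_eq_zero x hx :=
    h.exists_pow_smul_eq_zero x ((map_eq_zero_iff _ hσ.1).mp hx)

lemma of_bijective_comp {σ : S ⟶ T} (h : IsAway (ρ ≫ σ) f)
    (hρ : Function.Bijective (ringHom ρ)) : IsAway σ (evenMap ρ f) where
  isUnit := h.isUnit
  surj y := by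
    obtain ⟨n, x, hx⟩ := h.surj y
    exact ⟨n, ringHom ρ x, hx⟩
  exists_pow_smul_eq_zero x hx := by
    obtain ⟨x, rfl⟩ := hρ.2 x
    obtain ⟨n, hn⟩ := h.exists_pow_smul_eq_zero x hx
    exact ⟨n, by rw [← map_pow, ← ringHom_smul, hn, map_zero]⟩

end IsAway

end IsAway

section LocalizedModule

/-- Restriction of scalars along `R₀ → S₀` turns `S` into an `R₀`-module. -/
abbrev restrictScalarsEven (ρ : R ⟶ S) : Module R.Even S := Module.compHom S (evenMap ρ)

/-- A morphism of super-rings `ρ : R ⟶ S`, viewed as a homomorphism of `R₀`-modules. -/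
def evenLinearMap (ρ : R ⟶ S) : letI := restrictScalarsEven ρ; R →ₗ[R.Even] S :=
  letI := restrictScalarsEven ρ
  { toFun := ringHom ρ
    map_add' := map_add _
    map_smul' := ringHom_smul _ }

lemma IsAway.isLocalizedModule {ρ : R ⟶ S} {f : R.Even} (h : IsAway ρ f) :
    letI := restrictScalarsEven ρ
    IsLocalizedModule.Away f (evenLinearMap ρ) := by
  let _ := restrictScalarsEven ρ
  refine .mk ?_ (fun y ↦ ?_) fun x y ↦ h.exists_pow_smul_eq_pow_smul
  · obtain ⟨u, hu⟩ := h.isUnit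
    have hbij : Function.Bijective fun x : S ↦ evenMap ρ f • x := hu ▸ MulAction.bijective u
    exact (Module.End.isUnit_iff _).mpr hbij
  · obtain ⟨n, x, hx⟩ := h.surj y
    exact ⟨n, x, (congrArg (· • y) (map_pow (evenMap ρ) f n)).trans hx⟩

end LocalizedModule

section FiniteType

variable {K : Type v} [CommRing K]

/-- Through `φ : K → R₀`, the even part of `R` is a `K`-algebra of finite type, and `R` is a finite
module over its even part. Unlike being finitely generated as a `K`-superalgebra, both conditions
are local on the spectrum of `R₀` by results on commutative rings. -/
structure IsFiniteTypeOver (R : SuperRing.{u}) (φ : K →+* R.Even) : Prop where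
  finiteType : φ.FiniteType
  finite : Module.Finite R.Even R

variable {φ : K →+* R.Even}

lemma IsFiniteTypeOver.isNoetherian [IsNoetherianRing K] (hφ : R.IsFiniteTypeOver φ) :
    R.IsNoetherian := by
  let _ := φ.toAlgebra
  have : Algebra.FiniteType K R.Even := hφ.finiteType
  have : IsNoetherianRing R.Even := Algebra.FiniteType.isNoetherianRing K R.Even
  have := hφ.finite
  have hmono : StrictMono fun I : HomogeneousIdeal R.grading ↦ I.toIdeal.restrictScalars R.Even :=
    fun _ _ hIJ ↦ hIJ
  exact hmono.wellFoundedGT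

lemma IsFiniteTypeOver.of_isAway (hφ : R.IsFiniteTypeOver φ) {ρ : R ⟶ S} {f : R.Even}
    (h : IsAway ρ f) : S.IsFiniteTypeOver ((evenMap ρ).comp φ) := by
  let _ := (evenMap ρ).toAlgebra
  let _ := restrictScalarsEven ρ
  have : IsScalarTower R.Even S.Even S := ⟨fun a b x ↦ mul_smul (evenMap ρ a) b x⟩
  have := h.isLocalization
  have := h.isLocalizedModule
  have := hφ.finite
  have hρ : (evenMap ρ).FiniteType :=
    IsLocalization.finiteType_of_monoid_fg (Submonoid.powers f) S.Even
  exact ⟨hρ.comp hφ.finiteType, .of_isLocalizedModule (Submonoid.powers f) (evenLinearMap ρ)⟩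

lemma finiteType_of_span_eq_top {t : Set R.Even} (ht : Ideal.span t = ⊤)
    (h : ∀ f ∈ t, ∃ (S : SuperRing.{u}) (ρ : R ⟶ S),
      IsAway ρ f ∧ ((evenMap ρ).comp φ).FiniteType) :
    φ.FiniteType := by
  let _ := φ.toAlgebra
  refine Algebra.FiniteType.of_span_eq_top_target t ht fun f hf ↦ ?_
  obtain ⟨S, ρ, hρ, hS⟩ := h f hf
  let _ := (evenMap ρ).toAlgebra
  let _ := ((evenMap ρ).comp φ).toAlgebra
  have : IsScalarTower K R.Even S.Even := .of_algebraMap_eq' rfl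
  have := hρ.isLocalization
  have : Algebra.FiniteType K S.Even := hS
  exact this.equiv ((IsLocalization.algEquiv (Submonoid.powers f) S.Even
    (Localization.Away f)).restrictScalars K)

lemma finite_of_span_eq_top {t : Set R.Even} (ht : Ideal.span t = ⊤)
    (h : ∀ f ∈ t, ∃ (S : SuperRing.{u}) (ρ : R ⟶ S), IsAway ρ f ∧ Module.Finite S.Even S) :
    Module.Finite R.Even R := by
  choose S ρ hρ hfin using fun f : t ↦ h f f.2
  let _ (f : t) := (evenMap (ρ f)).toAlgebra
  let _ (f : t) := restrictScalarsEven (ρ f)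
  have (f : t) : IsScalarTower R.Even (S f).Even (S f) :=
    ⟨fun a b x ↦ mul_smul (evenMap (ρ f) a) b x⟩
  have (f : t) : IsLocalization.Away f.1 (S f).Even := (hρ f).isLocalization
  have (f : t) : IsLocalizedModule.Away f.1 (evenLinearMap (ρ f)) := (hρ f).isLocalizedModule
  exact Module.Finite.of_localizationSpan' t ht (Rₚ := fun f ↦ (S f).Even)
    (fun f ↦ evenLinearMap (ρ f)) hfin

lemma IsFiniteTypeOver.of_forall_exists_isAway
    (h : ∀ p : PrimeSpectrum R.Even, ∃ f ∉ p.asIdeal, ∃ (S : SuperRing.{u}) (ρ : R ⟶ S),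
      IsAway ρ f ∧ S.IsFiniteTypeOver ((evenMap ρ).comp φ)) :
    R.IsFiniteTypeOver φ := by
  let t : Set R.Even := {f | ∃ (S : SuperRing.{u}) (ρ : R ⟶ S),
    IsAway ρ f ∧ S.IsFiniteTypeOver ((evenMap ρ).comp φ)}
  have ht : Ideal.span t = ⊤ := by
    by_contra hne
    obtain ⟨m, hm, hle⟩ := Ideal.exists_le_maximal _ hne
    obtain ⟨f, hf, hft⟩ := h ⟨m, hm.isPrime⟩
    exact hf (hle (Ideal.subset_span hft))
  exact ⟨finiteType_of_span_eq_top ht fun _ ⟨S, ρ, hρ, hS⟩ ↦ ⟨S, ρ, hρ, hS.finiteType⟩,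
    finite_of_span_eq_top ht fun _ ⟨S, ρ, hρ, hS⟩ ↦ ⟨S, ρ, hρ, hS.finite⟩⟩

end FiniteType

section FinitelyGenerated

lemma adjoin_toSubmodule_eq_one_sup_span {A B : Type*} [CommSemiring A] [Semiring B] [Algebra A B]
    {z : Set B} (hz : ∀ x ∈ z, ∀ y ∈ z, x * y ∈ (1 : Submodule A B)) :
    (Algebra.adjoin A z).toSubmodule = 1 ⊔ Submodule.span A z := by
  let M := Submodule.span A z
  have hM : M * M ≤ 1 := by
    rw [Submodule.span_mul_span, Submodule.span_le]
    exact Set.mul_subset_iff.mpr hz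
  have hmul : (1 ⊔ M) * (1 ⊔ M) ≤ 1 ⊔ M := by
    rw [Submodule.sup_mul, one_mul, Submodule.mul_sup, mul_one]
    exact sup_le le_rfl (sup_le le_sup_right (hM.trans le_sup_left))
  refine le_antisymm ?_ (sup_le ?_ (Submodule.span_le.mpr Algebra.subset_adjoin))
  · have hle : Algebra.adjoin A z ≤ (1 ⊔ M).toSubalgebra (Submodule.one_le.mp le_sup_left)
        fun _ _ hx hy ↦ hmul (Submodule.mul_mem_mul hx hy) :=
      Algebra.adjoin_le fun x hx ↦ Submodule.mem_sup_right (Submodule.subset_span hx)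
    exact hle
  · exact Submodule.one_le.mpr (one_mem (Algebra.adjoin A z))

lemma proj_zero_of_odd {x : R} (hx : x ∈ R.grading 1) : R.proj 0 x = 0 :=
  DirectSum.decompose_of_mem_ne R.grading hx (by decide)

lemma isFiniteTypeOver_of_one_sup_span_eq_top {K : Type v} [CommRing K] [Algebra K R.Even]
    {A : Subalgebra K R.Even} (hA : A.FG) {z : Set R} (hz : z.Finite)
    (hodd : ∀ x ∈ z, x ∈ R.grading 1) (htop : 1 ⊔ Submodule.span A z = ⊤) :
    R.IsFiniteTypeOver (algebraMap K R.Even) := by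
  have hker : Submodule.span A z ≤ (LinearMap.ker (R.proj 0)).restrictScalars A :=
    Submodule.span_le.mpr fun x hx ↦ proj_zero_of_odd (hodd x hx)
  -- The even component of `b + m`, with `m` in the span of odd elements, is `b` itself.
  have hAtop : A = ⊤ := by
    refine eq_top_iff.mpr fun a _ ↦ ?_
    obtain ⟨_, hb, m, hm, hab⟩ :=
      Submodule.mem_sup.mp (htop.ge (Submodule.mem_top (x := (a : R))))
    obtain ⟨b, rfl⟩ := Submodule.mem_one.mp hb
    have hba : (b.1 : R) = a := by
      rw [← proj_of_mem b.1.2, ← proj_of_mem a.2, ← hab, map_add, LinearMap.mem_ker.mp (hker hm),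
        add_zero]
      rfl
    exact Subtype.ext hba ▸ b.2
  have : Module.Finite A R := by
    refine ⟨htop ▸ .sup ?_ (Submodule.fg_span hz)⟩
    rw [Submodule.one_eq_span]
    exact Submodule.fg_span_singleton 1
  have hfin : Algebra.FiniteType K R.Even := ⟨hAtop ▸ hA⟩
  exact ⟨RingHom.finiteType_algebraMap.mpr hfin, .of_restrictScalars_finite A R.Even R⟩

lemma IsFinitelyGenerated.isFiniteTypeOver {K : Type v} [Field K] {φ : K →+* R.Even}
    (h : R.IsFinitelyGenerated φ) : R.IsFiniteTypeOver φ := by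
  obtain ⟨t, ht⟩ := h
  let _ := φ.toAlgebra
  let even (x : R) : R.Even := ⟨R.proj 0 x, R.proj_mem 0 x⟩
  let oddMul (x y : R) : R.Even := ⟨R.proj 1 x * R.proj 1 y,
    SetLike.mul_mem_graded (A := R.grading) (R.proj_mem 1 x) (R.proj_mem 1 y)⟩
  let e : Set R.Even := even '' t ∪ Set.image2 oddMul t t
  let A : Subalgebra K R.Even := Algebra.adjoin K e
  let z : Set R := R.proj 1 '' t
  have he : e.Finite :=
    (t.finite_toSet.image even).union (t.finite_toSet.image2 oddMul t.finite_toSet)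
  have hz : ∀ x ∈ z, ∀ y ∈ z, x * y ∈ (1 : Submodule A R) := by
    rintro _ ⟨x, hx, rfl⟩ _ ⟨y, hy, rfl⟩
    exact Submodule.mem_one.mpr
      ⟨⟨oddMul x y, Algebra.subset_adjoin (.inr (Set.mem_image2_of_mem hx hy))⟩, rfl⟩
  have hadjoin : Algebra.adjoin A z = ⊤ := by
    refine Algebra.toSubring_eq_top.mp (top_le_iff.mp (ht ▸ Subring.closure_le.mpr ?_))
    rintro x (⟨k, rfl⟩ | hx)
    · exact (Algebra.adjoin A z).algebraMap_mem (algebraMap K A k)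
    · have hx₀ : (even x : R) ∈ Algebra.adjoin A z := (Algebra.adjoin A z).algebraMap_mem
        (⟨even x, Algebra.subset_adjoin (.inl ⟨x, hx, rfl⟩)⟩ : A)
      have hx₁ : R.proj 1 x ∈ Algebra.adjoin A z := Algebra.subset_adjoin ⟨x, hx, rfl⟩
      exact R.proj_add x ▸ add_mem hx₀ hx₁
  refine isFiniteTypeOver_of_one_sup_span_eq_top (A := A)
    (Subalgebra.fg_def.mpr ⟨e, he, rfl⟩) (t.finite_toSet.image (R.proj 1)) ?_ ?_
  · rintro _ ⟨x, -, rfl⟩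
    exact R.proj_mem 1 x
  · rw [← adjoin_toSubmodule_eq_one_sup_span hz, hadjoin, Algebra.top_toSubmodule]

end FinitelyGenerated

section Localization

namespace IsAway

variable {ρ : R ⟶ S} {f : R.Even}

lemma isPrime_nilradical (h : IsAway ρ f) (hN : (nilradical R.Even).IsPrime)
    (hf : f ∉ nilradical R.Even) : (nilradical S.Even).IsPrime := by
  let _ := (evenMap ρ).toAlgebra
  have := h.isLocalization
  exact isPrime_nilradical_of_isLocalizationAway S.Even hN hf

lemma evenMap_mem_nilradical_iff (h : IsAway ρ f) (hN : (nilradical R.Even).IsPrime)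
    (hf : f ∉ nilradical R.Even) {a : R.Even} :
    evenMap ρ a ∈ nilradical S.Even ↔ a ∈ nilradical R.Even := by
  let _ := (evenMap ρ).toAlgebra
  have := h.isLocalization
  exact algebraMap_mem_nilradical_iff_of_isLocalizationAway hN hf

lemma Ksdim₀_eq {K : Type*} [Field K] {φ : K →+* R.Even} (hφ : φ.FiniteType) (h : IsAway ρ f)
    (hN : (nilradical R.Even).IsPrime) (hf : f ∉ nilradical R.Even) : S.Ksdim₀ = R.Ksdim₀ := by
  let _ := φ.toAlgebra
  let _ := (evenMap ρ).toAlgebra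
  have : Algebra.FiniteType K R.Even := hφ
  have := h.isLocalization
  exact ringKrullDim_eq_of_isLocalizationAway K hN hf

lemma torsionOf_le_nilradical_iff (h : IsAway ρ f) (hN : (nilradical R.Even).IsPrime)
    (hf : f ∉ nilradical R.Even) {x : R} :
    Ideal.torsionOf S.Even S (ringHom ρ x) ≤ nilradical S.Even ↔
      Ideal.torsionOf R.Even R x ≤ nilradical R.Even := by
  refine ⟨fun hle a ha ↦ ?_, fun hle b hb ↦ ?_⟩
  · refine (h.evenMap_mem_nilradical_iff hN hf).mp (hle ?_)
    rw [Ideal.mem_torsionOf_iff, ← ringHom_smul, (Ideal.mem_torsionOf_iff ..).mp ha, map_zero]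
  · obtain ⟨n, a, hab⟩ := h.surj_even b
    have hax : ringHom ρ (a • x) = 0 := by
      rw [ringHom_smul, ← hab, mul_smul, (Ideal.mem_torsionOf_iff ..).mp hb, smul_zero]
    obtain ⟨m, hm⟩ := h.exists_pow_smul_eq_zero _ hax
    have hfa : f ^ m * a ∈ nilradical R.Even :=
      hle ((Ideal.mem_torsionOf_iff ..).mpr ((mul_smul ..).trans hm))
    have ha := (hN.mem_or_mem hfa).resolve_left fun hfm ↦ hf (hN.mem_of_pow_mem m hfm)
    rw [← h.evenMap_mem_nilradical_iff hN hf, ← hab] at ha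
    exact (Ideal.unit_mul_mem_iff_mem _ (h.isUnit.pow n)).mp ha

lemma exists_pow_smul_prod_eq (h : IsAway ρ f) {s : ℕ} (y : Fin s → S)
    (hy : ∀ i, y i ∈ S.grading 1) :
    ∃ (n : ℕ) (x : Fin s → R), (∀ i, x i ∈ R.grading 1) ∧
      evenMap ρ f ^ n • (List.ofFn y).prod = ringHom ρ (List.ofFn x).prod := by
  induction s with
  | zero => exact ⟨0, Fin.elim0, fun i ↦ i.elim0, by simp⟩
  | succ s ih =>
    obtain ⟨m, x₀, hx₀, h₀⟩ := h.surj_of_mem (hy 0)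
    obtain ⟨n, x, hx, hxy⟩ := ih (fun i ↦ y i.succ) fun i ↦ hy i.succ
    refine ⟨m + n, Fin.cons x₀ x, Fin.cases hx₀ hx, ?_⟩
    rw [List.ofFn_succ, List.ofFn_cons, List.prod_cons, List.prod_cons, map_mul, ← h₀, ← hxy,
      smul_mul_smul_comm, pow_add]

end IsAway

lemma torsionOf_smul_of_isUnit {A M : Type*} [CommRing A] [AddCommGroup M] [Module A M] {a : A}
    (ha : IsUnit a) (x : M) : Ideal.torsionOf A M (a • x) = Ideal.torsionOf A M x := by
  ext b
  rw [Ideal.mem_torsionOf_iff, Ideal.mem_torsionOf_iff, smul_comm, ha.smul_eq_zero]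

lemma isSystemOfOddParameters_iff [FiniteRingKrullDim R.Even] (hN : (nilradical R.Even).IsPrime)
    {s : ℕ} {y : Fin s → R} :
    R.IsSystemOfOddParameters y ↔ (∀ i, y i ∈ R.grading 1) ∧
      Ideal.torsionOf R.Even R (List.ofFn y).prod ≤ nilradical R.Even :=
  and_congr_right fun _ ↦ ringKrullDim_eq_ringKrullDim_quotient_iff hN

namespace IsAway

variable {ρ : R ⟶ S} {f : R.Even}

lemma oddParameterLengths_eq [FiniteRingKrullDim R.Even] [FiniteRingKrullDim S.Even]
    (h : IsAway ρ f) (hN : (nilradical R.Even).IsPrime) (hf : f ∉ nilradical R.Even) :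
    S.oddParameterLengths = R.oddParameterLengths := by
  have hNS := h.isPrime_nilradical hN hf
  refine Set.Subset.antisymm ?_ ?_
  · rintro s ⟨y, hy⟩
    obtain ⟨hodd, hle⟩ := (isSystemOfOddParameters_iff hNS).mp hy
    obtain ⟨n, x, hx, hxy⟩ := h.exists_pow_smul_prod_eq y hodd
    refine ⟨x, (isSystemOfOddParameters_iff hN).mpr ⟨hx, ?_⟩⟩
    rwa [← h.torsionOf_le_nilradical_iff hN hf, ← hxy,
      torsionOf_smul_of_isUnit (h.isUnit.pow n)]
  · rintro s ⟨x, hx⟩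
    obtain ⟨hodd, hle⟩ := (isSystemOfOddParameters_iff hN).mp hx
    refine ⟨fun i ↦ ringHom ρ (x i),
      (isSystemOfOddParameters_iff hNS).mpr ⟨fun i ↦ ringHom_mem ρ (hodd i), ?_⟩⟩
    have hprod : (List.ofFn fun i ↦ ringHom ρ (x i)).prod = ringHom ρ (List.ofFn x).prod := by
      rw [map_list_prod, List.map_ofFn, Function.comp_def]
    rwa [hprod, h.torsionOf_le_nilradical_iff hN hf]

lemma Ksdim_eq {K : Type*} [Field K] {φ : K →+* R.Even} (hφ : φ.FiniteType) (h : IsAway ρ f)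
    (hN : (nilradical R.Even).IsPrime) (hf : f ∉ nilradical R.Even) : S.Ksdim = R.Ksdim := by
  have hdim : ringKrullDim S.Even = ringKrullDim R.Even := h.Ksdim₀_eq hφ hN hf
  let _ := φ.toAlgebra
  have : Algebra.FiniteType K R.Even := hφ
  have : Nontrivial R.Even := nontrivial_of_ne f 0 fun h₀ ↦ hf (h₀ ▸ zero_mem _)
  have : FiniteRingKrullDim R.Even := finiteRingKrullDim_of_finiteType K R.Even
  have : FiniteRingKrullDim S.Even := by
    rwa [finiteRingKrullDim_iff_ne_bot_and_top, hdim, ← finiteRingKrullDim_iff_ne_bot_and_top]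
  exact Prod.ext hdim (by rw [Ksdim, Ksdim, Ksdim₁, Ksdim₁, h.oddParameterLengths_eq hN hf])

end IsAway

end Localization

section Greatest

lemma mul_mul_self_of_odd {a : R} (ha : a ∈ R.grading 1) (x : R) : a * x * a = 0 := by
  obtain ⟨b, hb, c, hc, rfl⟩ := R.exists_even_add_odd x
  have hanti : a * c + c * a = 0 := by
    have hsq := R.odd_mul_self (a + c) (add_mem ha hc)
    rwa [add_mul, mul_add, mul_add, R.odd_mul_self a ha, R.odd_mul_self c hc, zero_add,
      add_zero] at hsq
  rw [mul_add, add_mul, ← R.even_mul_odd_comm b hb a ha, eq_neg_of_add_eq_zero_left hanti,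
    mul_assoc, neg_mul, mul_assoc, R.odd_mul_self a ha, mul_zero, mul_zero, neg_zero, add_zero]

lemma nodup_of_prod_ne_zero {l : List R} (hl : ∀ a ∈ l, a ∈ R.grading 1) (h : l.prod ≠ 0) :
    l.Nodup := by
  induction l with
  | nil => exact List.nodup_nil
  | cons a l ih =>
    rw [List.prod_cons] at h
    refine List.nodup_cons.mpr ⟨fun hal ↦ h ?_,
      ih (fun b hb ↦ hl b (List.mem_cons_of_mem _ hb)) (right_ne_zero_of_mul h)⟩
    obtain ⟨l₁, l₂, rfl⟩ := List.append_of_mem hal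
    rw [List.prod_append, List.prod_cons, ← mul_assoc, ← mul_assoc,
      mul_mul_self_of_odd (hl a List.mem_cons_self), zero_mul]

open Pointwise in
lemma prod_ofFn_eq_zero_of_mem_span {z : Finset R} (hz : ∀ a ∈ z, a ∈ R.grading 1) {s : ℕ}
    (hs : z.card < s) {y : Fin s → R} (hy : ∀ i, y i ∈ Submodule.span R.Even (z : Set R)) :
    (List.ofFn y).prod = 0 := by
  have hmonomial : ∀ w : Fin s → z, (List.ofFn fun i ↦ (w i : R)).prod = 0 := by
    intro w
    by_contra hw
    have hnodup := nodup_of_prod_ne_zero (List.forall_mem_ofFn_iff.mpr fun i ↦ hz _ (w i).2) hw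
    have hinj : Function.Injective w := (List.nodup_ofFn.mp hnodup).of_comp
    have hcard := Fintype.card_le_of_injective w hinj
    rw [Fintype.card_fin, Fintype.card_coe] at hcard
    exact hs.not_ge hcard
  have hpow : Submodule.span R.Even (z : Set R) ^ s = ⊥ := by
    rw [Submodule.span_pow, Submodule.span_eq_bot]
    intro x hx
    obtain ⟨w, rfl⟩ := Set.mem_pow.mp hx
    exact hmonomial w
  have hmem : (List.ofFn y).prod ∈ Submodule.span R.Even (z : Set R) ^ s :=
    Submodule.pow_subset_pow _ (Set.mem_pow.mpr ⟨fun i ↦ ⟨y i, hy i⟩, rfl⟩)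
  rwa [hpow] at hmem

lemma exists_finset_odd_span [Module.Finite R.Even R] :
    ∃ z : Finset R, (∀ a ∈ z, a ∈ R.grading 1) ∧
      ∀ x ∈ R.grading 1, x ∈ Submodule.span R.Even (z : Set R) := by
  classical
  obtain ⟨t, ht⟩ := Module.Finite.fg_top (R := R.Even) (M := R)
  refine ⟨t.image (R.proj 1), fun a ha ↦ ?_, fun x hx ↦ ?_⟩
  · obtain ⟨b, -, rfl⟩ := Finset.mem_image.mp ha
    exact R.proj_mem 1 b
  · rw [Finset.coe_image, ← Submodule.map_span, ht]
    exact ⟨x, trivial, proj_of_mem hx⟩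

lemma IsSystemOfOddParameters.prod_ne_zero [Nontrivial R.Even] {s : ℕ} {y : Fin s → R}
    (hy : R.IsSystemOfOddParameters y) : (List.ofFn y).prod ≠ 0 := by
  intro hprod
  have hdim := hy.2
  have : Subsingleton (R.Even ⧸ (⊤ : Ideal R.Even)) := Ideal.Quotient.subsingleton_iff.mpr rfl
  rw [hprod, Ideal.torsionOf_zero,
    ringKrullDim_eq_bot_of_subsingleton (R := R.Even ⧸ (⊤ : Ideal R.Even))] at hdim
  exact (Order.bot_lt_krullDim (α := PrimeSpectrum R.Even)).ne' hdim

lemma zero_mem_oddParameterLengths : 0 ∈ R.oddParameterLengths := by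
  refine ⟨Fin.elim0, fun i ↦ i.elim0, ?_⟩
  have htors : Ideal.torsionOf R.Even R (List.ofFn (Fin.elim0 : Fin 0 → R)).prod = ⊥ := by
    refine (Submodule.eq_bot_iff _).mpr fun a ha ↦ Subtype.ext ?_
    rwa [Ideal.mem_torsionOf_iff, List.ofFn_zero, List.prod_nil, even_smul_def, mul_one] at ha
  rw [htors]
  exact (ringKrullDim_eq_of_ringEquiv (RingEquiv.quotientBot R.Even)).symm

lemma exists_isGreatest_oddParameterLengths [Module.Finite R.Even R] [Nontrivial R.Even] :
    ∃ s : ℕ, IsGreatest R.oddParameterLengths s := by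
  obtain ⟨z, hz, hspan⟩ := exists_finset_odd_span (R := R)
  have hbdd : z.card ∈ upperBounds R.oddParameterLengths := by
    rintro s ⟨y, hy⟩
    by_contra! hs
    exact hy.prod_ne_zero (prod_ofFn_eq_zero_of_mem_span hz hs fun i ↦ hspan _ (hy.1 i))
  exact ⟨sSup R.oddParameterLengths,
    Nat.sSup_mem ⟨0, zero_mem_oddParameterLengths⟩ ⟨_, hbdd⟩, fun s hs ↦ le_csSup ⟨_, hbdd⟩ hs⟩

lemma Ksdim₁_eq_of_isGreatest {s : ℕ} (h : IsGreatest R.oddParameterLengths s) : R.Ksdim₁ = s :=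
  le_antisymm (iSup₂_le fun _ hn ↦ Nat.cast_le.mpr (h.2 hn))
    (le_iSup₂ (f := fun (n : ℕ) (_ : n ∈ R.oddParameterLengths) ↦ (n : ℕ∞)) s h.1)

lemma IsFiniteTypeOver.exists_Ksdim_eq {K : Type v} [Field K] {φ : K →+* R.Even}
    [Nontrivial R.Even] (hφ : R.IsFiniteTypeOver φ) :
    ∃ d : ℕ × ℕ, IsGreatest R.oddParameterLengths d.2 ∧
      R.Ksdim = ((d.1 : WithBot ℕ∞), (d.2 : ℕ∞)) := by
  let _ := φ.toAlgebra
  have : Algebra.FiniteType K R.Even := hφ.finiteType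
  have : FiniteRingKrullDim R.Even := finiteRingKrullDim_of_finiteType K R.Even
  have := hφ.finite
  obtain ⟨r, hr⟩ := exists_ringKrullDim_eq_natCast R.Even
  obtain ⟨s, hs⟩ := exists_isGreatest_oddParameterLengths (R := R)
  exact ⟨(r, s), hs, Prod.ext hr (Ksdim₁_eq_of_isGreatest hs)⟩

end Greatest

section StructureSheaf

/-- An element of `R`, viewed as the section `r / 1` of the structure sheaf of `SSpec R`. -/
def toSpecSections (R : SuperRing.{u}) (U : Opens R.specTop) : R ⟶ R.specSuperRing U where
  toFun r := ⟨fun _ ↦ LocalizedModule.mk r 1, fun _ ↦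
    ⟨⊤, trivial, r, 1, fun q _ ↦ ⟨q.1.asIdeal.primeCompl.one_mem, rfl⟩⟩⟩
  map_one' := Subtype.ext (funext fun _ ↦ OreLocalization.one_def.symm)
  map_mul' _ _ := Subtype.ext (funext fun _ ↦
    (LocalizedModule.mk_mul_mk.trans (by rw [one_mul])).symm)
  map_zero' := Subtype.ext (funext fun _ ↦ LocalizedModule.zero_mk 1)
  map_add' _ _ := Subtype.ext (funext fun _ ↦
    (LocalizedModule.mk_add_mk.trans (by rw [one_mul, one_smul, one_smul])).symm)
  map_mem {_ r} hr _ := ⟨r, hr, 1, rfl⟩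

lemma toSpecSections_comp_specRes {U V : Opens R.specTop} (h : V ≤ U) :
    R.toSpecSections U ≫ R.specRes h = R.toSpecSections V := rfl

/-- The sections of the structure sheaf of `SSpec R`, compared with those of Mathlib's sheaf on the
spectrum of `R₀` associated with the `R₀`-module `R`. -/
def toStructureSheaf {U : Opens R.specTop} (h : R.specSections U) :
    (structureSheafInType R.Even R).obj.obj (op U) :=
  ⟨h.1, fun p ↦ by
    obtain ⟨V, hV, r, s, e⟩ := R.specSections_isLocallyFraction h p
    exact ⟨V ⊓ U, ⟨hV, p.2⟩, homOfLE inf_le_right, r, s, fun q ↦ e ⟨q.1, q.2.2⟩ q.2.1⟩⟩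

lemma toStructureSheaf_injective {U : Opens R.specTop} :
    Function.Injective (toStructureSheaf (U := U)) :=
  fun _ _ h ↦ Subtype.ext
    (congrArg (fun z : (structureSheafInType R.Even R).obj.obj (op U) ↦ z.1) h)

lemma toStructureSheaf_toSpecSections (U : Opens R.specTop) (x : R) :
    toStructureSheaf (ringHom (R.toSpecSections U) x) = StructureSheaf.toOpenₗ R.Even R U x :=
  (StructureSheaf.toOpenₗ_eq_const U x).symm

lemma toStructureSheaf_smul {U : Opens R.specTop} (a : R.Even) (y : R.specSuperRing U) :
    toStructureSheaf (evenMap (R.toSpecSections U) a • y) = a • toStructureSheaf y := by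
  refine Subtype.ext (funext fun p ↦ ?_)
  change LocalizedModule.mk (a : R) 1 * y.1 p = a • y.1 p
  induction y.1 p using LocalizedModule.induction_on with
  | h r s => rw [LocalizedModule.mk_mul_mk, one_mul, LocalizedModule.smul'_mk, even_smul_def]

lemma isUnit_evenMap_toSpecSections_basicOpen (f : R.Even) :
    IsUnit (evenMap (R.toSpecSections (PrimeSpectrum.basicOpen f)) f) := by
  let inverse : R.specSections (PrimeSpectrum.basicOpen f) :=
    ⟨fun p ↦ LocalizedModule.mk 1 ⟨f, p.2⟩, fun _ ↦ ⟨⊤, trivial, 1, f, fun q _ ↦ ⟨q.2, rfl⟩⟩⟩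
  let evenInverse : (R.specSuperRing (PrimeSpectrum.basicOpen f)).Even :=
    ⟨inverse, fun p ↦ ⟨1, SetLike.one_mem_graded R.grading, ⟨f, p.2⟩, rfl⟩⟩
  refine IsUnit.of_mul_eq_one evenInverse (Subtype.ext (Subtype.ext (funext fun p ↦ ?_)))
  change (LocalizedModule.mk (f : R) 1 * LocalizedModule.mk (1 : R) ⟨f, p.2⟩ : R.AtPrime p.1) = 1
  rw [LocalizedModule.mk_mul_mk, one_mul, mul_one, OreLocalization.one_def]
  refine LocalizedModule.mk_eq.mpr ⟨1, ?_⟩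
  rw [one_smul, one_smul, one_smul]
  exact (mul_one _).symm

lemma isAway_toSpecSections_basicOpen (f : R.Even) :
    IsAway (R.toSpecSections (PrimeSpectrum.basicOpen f)) f := by
  let U : Opens R.specTop := PrimeSpectrum.basicOpen f
  have : IsLocalizedModule.Away f (StructureSheaf.toOpenₗ R.Even R U) := inferInstance
  refine ⟨isUnit_evenMap_toSpecSections_basicOpen f, fun y ↦ ?_, fun x hx ↦ ?_⟩
  · obtain ⟨⟨x, ⟨_, n, rfl⟩⟩, hx⟩ := IsLocalizedModule.surj (Submonoid.powers f)
      (StructureSheaf.toOpenₗ R.Even R U) (toStructureSheaf y)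
    refine ⟨n, x, toStructureSheaf_injective ?_⟩
    rw [← map_pow]
    exact (toStructureSheaf_smul _ y).trans (hx.trans (toStructureSheaf_toSpecSections U x).symm)
  · have h0 : StructureSheaf.toOpenₗ R.Even R U x = 0 :=
      (toStructureSheaf_toSpecSections U x).symm.trans (congrArg toStructureSheaf hx)
    obtain ⟨⟨_, n, rfl⟩, hn⟩ := (IsLocalizedModule.eq_zero_iff (Submonoid.powers f)
      (StructureSheaf.toOpenₗ R.Even R U)).mp h0
    exact ⟨n, hn⟩

end StructureSheaf

end SuperRing

namespace GeometricSuperspace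

open SuperRing

variable {X : GeometricSuperspace.{u}} {U V W : Opens X.carrier}

section EvenSections

/-- The restriction map on even sections. -/
def evenRes (h : V ≤ U) : (X.sections U).Even →+* (X.sections V).Even :=
  evenMap (X.presheaf.map (homOfLE h).op)

lemma evenRes_comp (h : V ≤ U) (h' : W ≤ V) :
    (evenRes h').comp (evenRes h) = evenRes (X := X) (h'.trans h) := by
  rw [evenRes, evenRes, ← evenMap_comp, ← X.presheaf.map_comp]
  rfl

lemma evenRes_evenRes (h : V ≤ U) (h' : W ≤ V) (a : (X.sections U).Even) :
    evenRes h' (evenRes h a) = evenRes (h'.trans h) a :=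
  RingHom.congr_fun (evenRes_comp h h') a

/-- The largest open subset of `U` on which the even section `f` over `U` is locally invertible. -/
def basicOpen (f : (X.sections U).Even) : Opens X.carrier :=
  sSup {V | ∃ h : V ≤ U, IsUnit (evenRes h f)}

lemma mem_basicOpen {f : (X.sections U).Even} {x : X.carrier} :
    x ∈ basicOpen f ↔ ∃ (V : Opens X.carrier) (h : V ≤ U), IsUnit (evenRes h f) ∧ x ∈ V :=
  Opens.mem_sSup.trans
    ⟨fun ⟨V, ⟨h, hf⟩, hx⟩ ↦ ⟨V, h, hf, hx⟩, fun ⟨V, h, hf, hx⟩ ↦ ⟨V, ⟨h, hf⟩, hx⟩⟩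

lemma basicOpen_le (f : (X.sections U).Even) : basicOpen f ≤ U :=
  sSup_le fun _ hV ↦ hV.1

lemma basicOpen_eq_of_isUnit {f : (X.sections U).Even} (hf : IsUnit f) : basicOpen f = U :=
  (basicOpen_le f).antisymm (le_sSup ⟨le_rfl, hf.map _⟩)

lemma basicOpen_mul (f g : (X.sections U).Even) :
    basicOpen (f * g) = basicOpen f ⊓ basicOpen g := by
  ext x
  simp only [SetLike.mem_coe, Opens.mem_inf, mem_basicOpen]
  constructor
  · rintro ⟨V, h, hfg, hx⟩
    rw [map_mul, IsUnit.mul_iff] at hfg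
    exact ⟨⟨V, h, hfg.1, hx⟩, V, h, hfg.2, hx⟩
  · rintro ⟨⟨V, h, hf, hx⟩, V', h', hg, hx'⟩
    refine ⟨V ⊓ V', inf_le_left.trans h, ?_, hx, hx'⟩
    rw [map_mul, ← evenRes_evenRes h inf_le_left f, ← evenRes_evenRes h' inf_le_right g]
    exact (hf.map _).mul (hg.map _)

lemma basicOpen_evenRes (h : V ≤ U) (f : (X.sections U).Even) :
    basicOpen (evenRes h f) = V ⊓ basicOpen f := by
  refine le_antisymm (le_inf (basicOpen_le _) ?_) fun x ⟨hxV, hxf⟩ ↦ ?_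
  · refine sSup_le fun W ⟨hW, hf⟩ ↦ le_sSup ⟨hW.trans h, ?_⟩
    rwa [evenRes_evenRes] at hf
  · obtain ⟨W, hW, hf, hx⟩ := mem_basicOpen.mp hxf
    refine mem_basicOpen.mpr ⟨V ⊓ W, inf_le_left, ?_, hxV, hx⟩
    rw [evenRes_evenRes, ← evenRes_evenRes hW inf_le_right]
    exact hf.map _

end EvenSections

section Chart

lemma exists_isAway_comp_of_iso {R : SuperRing.{u}}
    (α : X.toSheafedSpace.restrict U.isOpenEmbedding ≅ SSpec R) :
    ∃ (a : R ⟶ X.sections U) (e : U ≃ₜ PrimeSpectrum R.Even),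
      ∀ (f : R.Even) (V : Opens X.carrier) (hV : V ≤ U),
        (∀ x (hx : x ∈ U), x ∈ V ↔ f ∉ (e ⟨x, hx⟩).asIdeal) →
          IsAway (a ≫ X.presheaf.map (homOfLE hV).op) f := by
  let F := U.isOpenEmbedding.functor
  let b := α.hom.hom.base
  have : IsIso b := inferInstance
  have : IsIso α.hom.hom.c := inferInstance
  let preimage (W : Opens R.specTop) : Opens X.carrier := F.obj ((Opens.map b).obj W)
  let c (W : Opens R.specTop) : R.specSuperRing W ⟶ X.sections (preimage W) :=
    α.hom.hom.c.app (op W)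
  have c_bijective (W) : Function.Bijective (ringHom (c W)) := by
    have : IsIso (c W) := inferInstanceAs (IsIso (α.hom.hom.c.app (op W)))
    exact ringHom_bijective _
  have mem_preimage (W x) (hx : x ∈ U) : x ∈ preimage W ↔ b ⟨x, hx⟩ ∈ W :=
    ⟨fun ⟨_, hy, hyx⟩ ↦ by subst hyx; exact hy, fun h ↦ ⟨⟨x, hx⟩, h, rfl⟩⟩
  have le_top_preimage : U ≤ preimage ⊤ := fun x hx ↦ (mem_preimage ⊤ x hx).mpr trivial
  refine ⟨R.toSpecSections ⊤ ≫ c ⊤ ≫ X.presheaf.map (homOfLE le_top_preimage).op,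
    TopCat.homeoOfIso (asIso b), fun f V hV mem_V ↦ ?_⟩
  obtain rfl : preimage (PrimeSpectrum.basicOpen f) = V := by
    ext x
    by_cases hx : x ∈ U
    · exact (mem_preimage _ x hx).trans (mem_V x hx).symm
    · exact ⟨fun ⟨y, _, hyx⟩ ↦ absurd (hyx ▸ y.2) hx, fun h ↦ absurd (hV h) hx⟩
  have c_naturality : R.specRes le_top ≫ c (PrimeSpectrum.basicOpen f) = c ⊤ ≫
      X.presheaf.map (F.map ((Opens.map b).map (homOfLE le_top))).op :=
    α.hom.hom.c.naturality (homOfLE (le_top : PrimeSpectrum.basicOpen f ≤ ⊤)).op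
  have h := (isAway_toSpecSections_basicOpen f).comp_bijective (c_bijective _)
  rw [← toSpecSections_comp_specRes le_top, Category.assoc, c_naturality] at h
  rw [Category.assoc, Category.assoc, ← X.presheaf.map_comp]
  exact h

/-- A homeomorphism of `U` with the spectrum of the even sections over `U` for which restriction to
the preimage of each basic open set `D(f)` is localization away from `f`. -/
def IsChart (e : U ≃ₜ PrimeSpectrum (X.sections U).Even) : Prop :=
  ∀ (f : (X.sections U).Even) (V : Opens X.carrier) (hV : V ≤ U),
    (∀ x (hx : x ∈ U), x ∈ V ↔ f ∉ (e ⟨x, hx⟩).asIdeal) →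
      IsAway (X.presheaf.map (homOfLE hV).op) f

lemma IsAffineOpen.exists_isChart (hU : X.IsAffineOpen U) :
    ∃ e : U ≃ₜ PrimeSpectrum (X.sections U).Even, IsChart e := by
  obtain ⟨R, ⟨α⟩⟩ := hU
  obtain ⟨a, e, isAway⟩ := exists_isAway_comp_of_iso α
  have a_bijective : Function.Bijective (ringHom a) := by
    have isAway_one := isAway 1 U le_rfl fun x hx ↦
      iff_of_true hx ((e ⟨x, hx⟩).asIdeal.ne_top_iff_one.mp (e ⟨x, hx⟩).isPrime.ne_top)
    have map_self : X.presheaf.map (homOfLE (le_refl U)).op = 𝟙 (X.sections U) :=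
      X.presheaf.map_id _
    rw [map_self, Category.comp_id] at isAway_one
    exact isAway_one.bijective_of_one
  let aEven : R.Even ≃+* (X.sections U).Even :=
    RingEquiv.ofBijective _ (evenMap_bijective a_bijective)
  refine ⟨e.trans (PrimeSpectrum.homeomorphOfRingEquiv aEven), fun f V hV mem_V ↦ ?_⟩
  obtain ⟨f, rfl⟩ := aEven.surjective f
  refine (isAway f V hV fun x hx ↦ (mem_V x hx).trans ?_).of_bijective_comp a_bijective
  change ¬ (aEven.symm (aEven f) ∈ (e ⟨x, hx⟩).asIdeal) ↔ _
  rw [aEven.symm_apply_apply]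

variable {e : U ≃ₜ PrimeSpectrum (X.sections U).Even}

lemma exists_opens_mem_iff (e : U ≃ₜ PrimeSpectrum (X.sections U).Even)
    (f : (X.sections U).Even) :
    ∃ V ≤ U, ∀ x (hx : x ∈ U), x ∈ V ↔ f ∉ (e ⟨x, hx⟩).asIdeal := by
  let D : Opens U := ⟨e ⁻¹' PrimeSpectrum.basicOpen f,
    (PrimeSpectrum.basicOpen f).isOpen.preimage e.continuous⟩
  refine ⟨U.isOpenEmbedding.functor.obj D, ?_, fun x hx ↦ ?_⟩
  · rintro _ ⟨y, _, rfl⟩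
    exact y.2
  · exact ⟨fun ⟨y, hy, hyx⟩ ↦ by subst hyx; exact hy, fun hf ↦ ⟨⟨x, hx⟩, hf, rfl⟩⟩

lemma exists_notMem_and_forall_mem (e : U ≃ₜ PrimeSpectrum (X.sections U).Even) (hVU : V ≤ U)
    {x : X.carrier} (hx : x ∈ V) :
    ∃ f ∉ (e ⟨x, hVU hx⟩).asIdeal, ∀ y (hy : y ∈ U), f ∉ (e ⟨y, hy⟩).asIdeal → y ∈ V := by
  have image_isOpen : IsOpen (e '' (Subtype.val ⁻¹' (V : Set X.carrier))) :=
    e.isOpenMap _ (V.isOpen.preimage continuous_subtype_val)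
  obtain ⟨_, ⟨_, ⟨f, rfl⟩, rfl⟩, hxf, hfV⟩ :=
    PrimeSpectrum.isBasis_basic_opens.exists_subset_of_mem_open
      (Set.mem_image_of_mem e (show (⟨x, hVU hx⟩ : U) ∈ _ from hx)) image_isOpen
  exact ⟨f, hxf, fun y hy hyf ↦ (e.injective.mem_set_image).mp (hfV hyf)⟩

lemma IsChart.mem_basicOpen_iff (he : IsChart e) {f : (X.sections U).Even} {x : X.carrier}
    (hx : x ∈ U) : x ∈ basicOpen f ↔ f ∉ (e ⟨x, hx⟩).asIdeal := by
  refine mem_basicOpen.trans ⟨fun ⟨V, hV, hf, hxV⟩ hfx ↦ ?_, fun hfx ↦ ?_⟩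
  · obtain ⟨g, hgx, hgV⟩ := exists_notMem_and_forall_mem e hV hxV
    obtain ⟨W, hW, mem_W⟩ := exists_opens_mem_iff e g
    have hWV : W ≤ V := fun y hy ↦ hgV y (hW hy) ((mem_W y (hW hy)).mp hy)
    have isUnit_W : IsUnit (evenRes hW f) := by
      rw [← evenRes_evenRes hV hWV]
      exact hf.map _
    obtain ⟨n, hn⟩ := (he g W hW mem_W).exists_dvd_pow isUnit_W
    exact hgx ((e ⟨x, hx⟩).isPrime.mem_of_pow_mem n (Ideal.mem_of_dvd _ hn hfx))
  · obtain ⟨W, hW, mem_W⟩ := exists_opens_mem_iff e f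
    exact ⟨W, hW, (he f W hW mem_W).isUnit, (mem_W x hx).mpr hfx⟩

lemma IsChart.isAway (he : IsChart e) (f : (X.sections U).Even) :
    IsAway (X.presheaf.map (homOfLE (basicOpen_le f)).op) f :=
  he f _ _ fun _ ↦ he.mem_basicOpen_iff

lemma IsChart.exists_mem_basicOpen_le (he : IsChart e) {x : X.carrier} (hxU : x ∈ U)
    (hxV : x ∈ V) : ∃ f : (X.sections U).Even, x ∈ basicOpen f ∧ basicOpen f ≤ V := by
  obtain ⟨f, hfx, hfV⟩ := exists_notMem_and_forall_mem e (inf_le_left : U ⊓ V ≤ U) ⟨hxU, hxV⟩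
  refine ⟨f, (he.mem_basicOpen_iff hxU).mpr hfx, fun y hy ↦ ?_⟩
  have hyU := basicOpen_le f hy
  exact (hfV y hyU ((he.mem_basicOpen_iff hyU).mp hy)).2

lemma IsChart.exists_basicOpen_eq_basicOpen {e' : V ≃ₜ PrimeSpectrum (X.sections V).Even}
    (he : IsChart e) (he' : IsChart e') {x : X.carrier} (hxU : x ∈ U) (hxV : x ∈ V) :
    ∃ (f : (X.sections U).Even) (g : (X.sections V).Even),
      x ∈ basicOpen f ∧ basicOpen f = basicOpen g := by
  obtain ⟨f, hxf, hfV⟩ := he.exists_mem_basicOpen_le hxU hxV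
  obtain ⟨g, hxg, hgf⟩ := he'.exists_mem_basicOpen_le hxV hxf
  have isUnit_f : IsUnit (evenRes (basicOpen_le f) f) := (he.isAway f).isUnit
  -- On `D(f)` the section `g` is a fraction `a / f ^ n`, whence `D(g) = D(f * a)`.
  obtain ⟨n, a, ha⟩ := (he.isAway f).surj_even (evenRes hfV g)
  have basicOpen_eq : basicOpen g = basicOpen (f * a) :=
    calc basicOpen g = basicOpen f ⊓ basicOpen g := (inf_eq_right.mpr hgf).symm
      _ = basicOpen (evenRes hfV g) := (basicOpen_evenRes hfV g).symm
      _ = basicOpen (evenRes (basicOpen_le f) f ^ n * evenRes hfV g) := by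
        rw [basicOpen_mul, basicOpen_eq_of_isUnit (isUnit_f.pow n),
          inf_eq_right.mpr (basicOpen_le _)]
      _ = basicOpen (evenRes (basicOpen_le f) a) := congrArg basicOpen ha
      _ = basicOpen (f * a) := by rw [basicOpen_evenRes, basicOpen_mul]
  exact ⟨f * a, g, basicOpen_eq ▸ hxg, basicOpen_eq.symm⟩

end Chart

section Irreducible

variable [IrreducibleSpace X.carrier]

lemma isPrime_nilradical_of_homeomorph (e : U ≃ₜ PrimeSpectrum (X.sections U).Even)
    (hU : (U : Set X.carrier).Nonempty) : (nilradical (X.sections U).Even).IsPrime := by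
  rw [← PrimeSpectrum.irreducibleSpace_iff_isPrime_nilradical, ← e.irreducibleSpace_iff]
  have : Nonempty U := hU.to_subtype
  exact U.isOpen.isOpenEmbedding_subtypeVal.irreducibleSpace

lemma IsChart.Ksdim_basicOpen_eq {K : Type*} [Field K] {e : U ≃ₜ PrimeSpectrum (X.sections U).Even}
    (he : IsChart e) {φ : K →+* (X.sections U).Even} (hφ : φ.FiniteType)
    {f : (X.sections U).Even} {x : X.carrier} (hx : x ∈ basicOpen f) :
    (X.sections (basicOpen f)).Ksdim = (X.sections U).Ksdim := by
  have hxU := basicOpen_le f hx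
  refine (he.isAway f).Ksdim_eq hφ (isPrime_nilradical_of_homeomorph e ⟨x, hxU⟩) fun hf ↦ ?_
  exact (he.mem_basicOpen_iff hxU).mp hx (nilradical_le_prime (e ⟨x, hxU⟩).asIdeal hf)

end Irreducible

end GeometricSuperspace

namespace Superscheme

open SuperRing GeometricSuperspace

variable {K : Type v} [Field K] {X : Superscheme.{u}} {φ : X.StructureMap K}

lemma evenMap_comp_structureMapOn {U V : Opens X.carrier} (h : V ≤ U) :
    (evenMap (X.presheaf.map (homOfLE h).op)).comp (X.structureMapOn φ U) =
      X.structureMapOn φ V := by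
  change (evenRes (X := X.toGeometricSuperspace) h).comp ((evenRes le_top).comp φ) = _
  rw [← RingHom.comp_assoc, evenRes_comp]
  rfl

/-- `X` is locally of finite type over `K`: it is covered by open affine super-subschemes whose
super-rings of sections are finitely generated `K`-superalgebras. -/
def IsLocallyOfFiniteType (X : Superscheme.{u}) (φ : X.StructureMap K) : Prop :=
  ∀ x : X.carrier, ∃ U : Opens X.carrier, x ∈ U ∧ X.IsAffineOpen U ∧
    (X.sections U).IsFinitelyGenerated (X.structureMapOn φ U)

lemma IsOfFiniteType.isLocallyOfFiniteType (hX : X.IsOfFiniteType φ) :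
    X.IsLocallyOfFiniteType φ := by
  obtain ⟨n, U, hU, hft⟩ := hX
  intro x
  obtain ⟨i, hi⟩ := Opens.mem_iSup.mp (hU ▸ trivial : x ∈ ⨆ i, U i)
  exact ⟨U i, hi, hft i⟩

namespace IsLocallyOfFiniteType

variable {U V : Opens X.carrier}

lemma isFiniteTypeOver (hX : X.IsLocallyOfFiniteType φ) (hU : X.IsAffineOpen U) :
    (X.sections U).IsFiniteTypeOver (X.structureMapOn φ U) := by
  obtain ⟨e, he⟩ := hU.exists_isChart
  refine .of_forall_exists_isAway fun p ↦ ?_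
  obtain ⟨⟨x, hxU⟩, rfl⟩ := e.surjective p
  obtain ⟨V, hxV, hV, hfg⟩ := hX x
  obtain ⟨e', he'⟩ := hV.exists_isChart
  obtain ⟨f, g, hxf, hfg_eq⟩ := he.exists_basicOpen_eq_basicOpen he' hxU hxV
  refine ⟨f, (he.mem_basicOpen_iff hxU).mp hxf, X.sections (basicOpen f), _, he.isAway f, ?_⟩
  rw [evenMap_comp_structureMapOn, hfg_eq, ← evenMap_comp_structureMapOn (basicOpen_le g)]
  exact hfg.isFiniteTypeOver.of_isAway (he'.isAway g)

lemma exists_Ksdim_eq (hX : X.IsLocallyOfFiniteType φ) (hU : X.IsAffineOpen U)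
    (hU' : (U : Set X.carrier).Nonempty) :
    ∃ d : ℕ × ℕ, IsGreatest (X.sections U).oddParameterLengths d.2 ∧
      (X.sections U).Ksdim = ((d.1 : WithBot ℕ∞), (d.2 : ℕ∞)) := by
  obtain ⟨x, hx⟩ := hU'
  obtain ⟨e, -⟩ := hU.exists_isChart
  have : Nontrivial (X.sections U).Even := PrimeSpectrum.nontrivial (e ⟨x, hx⟩)
  exact (hX.isFiniteTypeOver hU).exists_Ksdim_eq

variable [IrreducibleSpace X.carrier]

lemma Ksdim_eq (hX : X.IsLocallyOfFiniteType φ) (hU : X.IsAffineOpen U) (hV : X.IsAffineOpen V)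
    (hU' : (U : Set X.carrier).Nonempty) (hV' : (V : Set X.carrier).Nonempty) :
    (X.sections U).Ksdim = (X.sections V).Ksdim := by
  obtain ⟨x, hxU, hxV⟩ := nonempty_preirreducible_inter U.isOpen V.isOpen hU' hV'
  obtain ⟨e, he⟩ := hU.exists_isChart
  obtain ⟨e', he'⟩ := hV.exists_isChart
  obtain ⟨f, g, hxf, hfg⟩ := he.exists_basicOpen_eq_basicOpen he' hxU hxV
  calc (X.sections U).Ksdim
    _ = (X.sections (basicOpen f)).Ksdim :=
      (he.Ksdim_basicOpen_eq (hX.isFiniteTypeOver hU).finiteType hxf).symm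
    _ = (X.sections (basicOpen g)).Ksdim := by rw [hfg]
    _ = (X.sections V).Ksdim :=
      he'.Ksdim_basicOpen_eq (hX.isFiniteTypeOver hV).finiteType (hfg ▸ hxf)

end IsLocallyOfFiniteType

end Superscheme

end

lemma natCast_prod_injective :
    Function.Injective fun d : ℕ × ℕ ↦ ((d.1 : WithBot ℕ∞), (d.2 : ℕ∞)) :=
  Nat.cast_injective.prodMap Nat.cast_injective

theorem mainTheorem11_general {K : Type v} [Field K] (X : Superscheme.{u}) (φ : X.StructureMap K)
    (hft : X.IsLocallyOfFiniteType φ) (hirr : IrreducibleSpace X.carrier) :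
    (∀ U V : Opens X.carrier, X.IsAffineOpen U → X.IsAffineOpen V →
      (U : Set X.carrier).Nonempty → (V : Set X.carrier).Nonempty →
      (X.sections U).Ksdim = (X.sections V).Ksdim) ∧
    ∃! d : ℕ × ℕ, ∀ U : Opens X.carrier, X.IsAffineOpen U → (U : Set X.carrier).Nonempty →
      (X.sections U).IsNoetherian ∧
      IsGreatest (X.sections U).oddParameterLengths d.2 ∧
      (X.sections U).Ksdim = ((d.1 : WithBot ℕ∞), (d.2 : ℕ∞)) := by
  obtain ⟨x⟩ : Nonempty X.carrier := inferInstance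
  obtain ⟨V, hxV, hV⟩ := X.exists_isAffineOpen x
  obtain ⟨d, -, hd⟩ := hft.exists_Ksdim_eq hV ⟨x, hxV⟩
  refine ⟨fun U V ↦ hft.Ksdim_eq, d, fun U hU hU' ↦ ?_, fun d' hd' ↦ ?_⟩
  · obtain ⟨d', hgreatest, hd'⟩ := hft.exists_Ksdim_eq hU hU'
    obtain rfl : d' = d := natCast_prod_injective
      (hd'.symm.trans ((hft.Ksdim_eq hU hV hU' ⟨x, hxV⟩).trans hd))
    exact ⟨(hft.isFiniteTypeOver hU).isNoetherian, hgreatest, hd'⟩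
  · exact natCast_prod_injective ((hd' V hV ⟨x, hxV⟩).2.2.symm.trans hd)

theorem mainTheorem11 {K : Type v} [Field K] (X : Superscheme.{u}) (φ : X.StructureMap K)
    (hft : X.IsOfFiniteType φ) (hirr : IrreducibleSpace X.carrier) :
    (∀ U V : Opens X.carrier, X.IsAffineOpen U → X.IsAffineOpen V →
      (U : Set X.carrier).Nonempty → (V : Set X.carrier).Nonempty →
      (X.sections U).Ksdim = (X.sections V).Ksdim) ∧
    ∃! d : ℕ × ℕ, ∀ U : Opens X.carrier, X.IsAffineOpen U → (U : Set X.carrier).Nonempty →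
      (X.sections U).IsNoetherian ∧
      IsGreatest (X.sections U).oddParameterLengths d.2 ∧
      (X.sections U).Ksdim = ((d.1 : WithBot ℕ∞), (d.2 : ℕ∞)) :=
  mainTheorem11_general X φ hft.isLocallyOfFiniteType hirr
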